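/- Let $R$ be a commutative ring in which $2$ is invertible. Let $\mathrm{Cob}_{/l}(R)$ be the following category. Its objects are finite collections of circles $A$ with a formal degree shift, $A\{q\}$, $q\in\mathbb Z$. Its morphisms are the $R$-linear combinations of compact orientable (abstract) two-dimensional cobordisms, up to homeomorphism relative to the boundary, modulo the local relations S (a sphere component is $0$), T (a torus component is $2$) and 4TU ($C_{12}+C_{34}=C_{13}+C_{24}$, where $C_{ij}$ is obtained from a surface with four marked discs by replacing the $i$-th and the $j$-th disc by a tube). A surface $\Sigma\colon A\{q\}\to B\{q'\}$ has degree $\chi(\Sigma)+q'-q$. Let $\mathrm{Mat}(\mathrm{Cob}_{/l}(R))$ be the category of finite columns of objects and of matrices of morphisms; a matrix has degree $0$ if all of its entries have. For an oriented link diagram $D$ with $n_+$ positive and $n_-$ negative crossings let $[[D]]$ be Bar-Natan's complex over $\mathrm{Mat}(\mathrm{Cob}_{/l}(R))$, built from the cube of smoothings $v$ of $D$. Write $|v|$ for the number of $1$-smoothings in $v$. The chain object in homological degree $h$ is the column of all smoothings $v$ with $|v|=h+n_-$, each shifted by $\{|v|+n_+-2n_-\}$, and the differential is the matrix of signed saddles.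 Let $T$ have degree $-4$ and consider graded free $R[T]$-modules of finite rank with a chosen homogeneous basis, with all $R[T]$-linear maps as morphisms. Let $\Phi$ be the functor from these modules to $\mathrm{Mat}(\mathrm{Cob}_{/l}(R))$ that sends a free module with a basis in degrees $q_1,\dots,q_r$ to the column $(\emptyset\{q_1\},\dots,\emptyset\{q_r\})$, and a matrix over $R[T]$ to the matrix of closed surfaces obtained by letting $T$ be the $2$-handle operator in its genus-3 presentation: $T^k$ is $2^{-k}$ times the union of $k$ closed connected surfaces of genus $3$. **Theorem.** The functor $\Phi$ is full and faithful; in particular $\mathrm{End}(\emptyset)\cong R[T]$. For every oriented link diagram $D$ there is a complex $C$ of graded free $R[T]$-modules of finite rank, with differentials of degree $0$, such that $[[D]]$ is isomorphic to $\Phi(C)$ as a complex over $\mathrm{Mat}(\mathrm{Cob}_{/l}(R))$, by an isomorphism that, like its inverse, consists of maps of degree $0$; in particular the two complexes are homotopy equivalent. Moreover, $C$ can be chosen such that $C^h$ is obtained from the chain object $[[D]]^h$ by replacing every circle by two empty sets $\emptyset\{+1\}$, $\emptyset\{-1\}$: its basis is indexed by the pairs of a smoothing $v$ with $|v|=h+n_-$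 and an assignment of signs $\pm1$ to the circles of $v$, and the degree of such a basis element is $|v|+n_+-2n_-$ plus the sum of the signs. -/

import Mathlib

open CategoryTheory Polynomial

universe u

noncomputable section

/-! ### Surfaces and cobordisms -/

/-- A compact orientable surface whose boundary circles are labelled by `A` (incoming) and by `B`
(outgoing), recorded by its finite set `K` of connected components, the genus of every component,
and the component on which each boundary circle lies. -/
structure Surface (A B : Type) where
  K : Type
  [fintypeK : Fintype K]
  genus : K → ℕ
  src : A → K
  tgt : B → K

namespace Surface

attribute [instance] Surface.fintypeK

variable {A B C E : Type}

/-- Homeomorphism relative to the boundary. -/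
def Homeo (S T : Surface A B) : Prop :=
  ∃ e : S.K ≃ T.K, (∀ k, T.genus (e k) = S.genus k) ∧ (∀ a, e (S.src a) = T.src a) ∧
    ∀ b, e (S.tgt b) = T.tgt b

theorem Homeo.refl (S : Surface A B) : Homeo S S :=
  ⟨Equiv.refl _, by simp⟩

theorem Homeo.symm {S T : Surface A B} : Homeo S T → Homeo T S := by
  rintro ⟨e, h1, h2, h3⟩
  refine ⟨e.symm, fun k => ?_, fun a => ?_, fun b => ?_⟩
  · rw [← h1, e.apply_symm_apply]
  · rw [← h2, e.symm_apply_apply]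
  · rw [← h3, e.symm_apply_apply]

theorem Homeo.trans {S T U : Surface A B} : Homeo S T → Homeo T U → Homeo S U := by
  rintro ⟨e, h1, h2, h3⟩ ⟨f, k1, k2, k3⟩
  exact ⟨e.trans f, by simp [h1, k1], by simp [h2, k2], by simp [h3, k3]⟩

instance setoid (A B : Type) : Setoid (Surface A B) :=
  ⟨Homeo, Homeo.refl, Homeo.symm, Homeo.trans⟩

/-- The union of cylinders over the circles `A`. -/
def cylinder (A : Type) [Fintype A] : Surface A A where
  K := A
  genus _ := 0
  src a := a
  tgt a := a

/-- Gluing along the circle `b` brings together the two components that contain it. -/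
inductive Glue (S : Surface A B) (T : Surface B C) : S.K ⊕ T.K → S.K ⊕ T.K → Prop
  | mk (b : B) : Glue S T (Sum.inl (S.tgt b)) (Sum.inr (T.src b))

section gluing

variable [Fintype B] (S : Surface A B) (T : Surface B C)

open Classical in
instance : Fintype (Quot (Glue S T)) := Fintype.ofFinite _

/-- The genera of the pieces, before gluing. -/
def pieceGenus : S.K ⊕ T.K → ℕ := Sum.elim S.genus T.genus

open Classical in
/-- Gluing of surfaces along the circles `B`. The components of the result are the classes of
pieces, and a component made of `p` pieces that are glued along `c` circles has as its genus the
sum of the genera of the pieces plus `c + 1 - p`, the first Betti number of the connected gluing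
graph. -/
def glue : Surface A C where
  K := Quot (Glue S T)
  genus q :=
    (∑ x with Quot.mk (Glue S T) x = q, pieceGenus S T x) +
      (Fintype.card {b : B // Quot.mk (Glue S T) (Sum.inl (S.tgt b)) = q} + 1 -
        Fintype.card {x : S.K ⊕ T.K // Quot.mk (Glue S T) x = q})
  src a := Quot.mk _ (Sum.inl (S.src a))
  tgt c := Quot.mk _ (Sum.inr (T.tgt c))

open Classical in
theorem card_pieces_le (q : Quot (Glue S T)) :
    Fintype.card {x : S.K ⊕ T.K // Quot.mk (Glue S T) x = q} ≤
      Fintype.card {b : B // Quot.mk (Glue S T) (Sum.inl (S.tgt b)) = q} + 1 := by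
  set V := {x : S.K ⊕ T.K // Quot.mk (Glue S T) x = q}
  let G : SimpleGraph V := SimpleGraph.fromRel fun x y => Glue S T x.1 y.1
  have hne : Nonempty V := by
    obtain ⟨x, hx⟩ := Quot.exists_rep q
    exact ⟨⟨x, hx⟩⟩
  have hreach : ∀ x y : S.K ⊕ T.K, Relation.EqvGen (Glue S T) x y →
      ∀ (hx : Quot.mk (Glue S T) x = q) (hy : Quot.mk (Glue S T) y = q),
        G.Reachable ⟨x, hx⟩ ⟨y, hy⟩ := by
    intro x y h
    induction h with
    | rel x y h =>
      intro hx hy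
      by_cases hxy : x = y
      · subst hxy; exact SimpleGraph.Reachable.refl _
      · refine SimpleGraph.Adj.reachable ?_
        rw [SimpleGraph.fromRel_adj]
        exact ⟨fun h => hxy (congrArg Subtype.val h), Or.inl h⟩
    | refl x => intro hx hy; exact SimpleGraph.Reachable.refl _
    | symm x y _ ih => intro hx hy; exact (ih hy hx).symm
    | trans x y z h1 _ ih1 ih2 =>
      intro hx hz
      have hy : Quot.mk (Glue S T) y = q := (Quot.eqvGen_sound h1).symm.trans hx
      exact (ih1 hx hy).trans (ih2 hy hz)
  have hconn : G.Connected := by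
    refine SimpleGraph.Connected.mk ?_
    rintro ⟨x, hx⟩ ⟨y, hy⟩
    exact hreach x y (Quot.eqvGen_exact (hx.trans hy.symm)) hx hy
  have h1 := hconn.card_vert_le_card_edgeSet_add_one
  have h2 : Nat.card G.edgeSet ≤
      Nat.card {b : B // Quot.mk (Glue S T) (Sum.inl (S.tgt b)) = q} := by
    let f : {b : B // Quot.mk (Glue S T) (Sum.inl (S.tgt b)) = q} → Sym2 V := fun b =>
      s(⟨Sum.inl (S.tgt b.1), b.2⟩,
        ⟨Sum.inr (T.src b.1), (Quot.sound (Glue.mk b.1)).symm.trans b.2⟩)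
    have hsub : G.edgeSet ⊆ Set.range f := by
      intro e
      induction e using Sym2.ind with
      | _ x y =>
        intro he
        rw [SimpleGraph.mem_edgeSet, SimpleGraph.fromRel_adj] at he
        obtain ⟨x, hx⟩ := x
        obtain ⟨y, hy⟩ := y
        obtain ⟨-, h | h⟩ := he
        · cases h with
          | mk b => exact ⟨⟨b, hx⟩, rfl⟩
        · cases h with
          | mk b => exact ⟨⟨b, hy⟩, Sym2.eq_swap⟩
    calc Nat.card G.edgeSet ≤ Nat.card (Set.range f) :=
          Nat.card_mono (Set.toFinite _) hsub
      _ ≤ _ := Finite.card_range_le f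
  rw [← Nat.card_eq_fintype_card, ← Nat.card_eq_fintype_card]
  exact h1.trans (Nat.add_le_add_right h2 1)

/-- The genus minus one, which is additive up to the number of gluing circles. -/
def excess (S : Surface A B) (k : S.K) : ℤ := (S.genus k : ℤ) - 1

open Classical in
theorem glue_excess (q : Quot (Glue S T)) :
    (glue S T).excess q = (∑ x with Quot.mk (Glue S T) x = q, ((pieceGenus S T x : ℤ) - 1)) +
      ∑ b with Quot.mk (Glue S T) (Sum.inl (S.tgt b)) = q, (1 : ℤ) := by
  have h := card_pieces_le S T q
  rw [Fintype.card_subtype, Fintype.card_subtype] at h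
  simp only [excess, glue]
  rw [Fintype.card_subtype, Fintype.card_subtype, Finset.sum_sub_distrib]
  push_cast [Nat.cast_sub h]
  simp
  ring

theorem glue_sum (w : Quot (Glue S T) → ℤ) :
    ∑ q, w q * (glue S T).excess q =
      ∑ k, w (Quot.mk _ (Sum.inl k)) * S.excess k + ∑ k, w (Quot.mk _ (Sum.inr k)) * T.excess k +
        ∑ b, w (Quot.mk _ (Sum.inl (S.tgt b))) := by
  classical
  have h1 : ∀ q : Quot (Glue S T), w q * (glue S T).excess q =
      (∑ x with Quot.mk (Glue S T) x = q, w (Quot.mk _ x) * ((pieceGenus S T x : ℤ) - 1)) +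
      ∑ b with Quot.mk (Glue S T) (Sum.inl (S.tgt b)) = q,
        w (Quot.mk _ (Sum.inl (S.tgt b))) := by
    intro q
    rw [glue_excess, mul_add, Finset.mul_sum, Finset.mul_sum]
    congr 1
    · refine Finset.sum_congr rfl fun x hx => ?_
      rw [(Finset.mem_filter.1 hx).2]
    · refine Finset.sum_congr rfl fun x hx => ?_
      rw [(Finset.mem_filter.1 hx).2, mul_one]
  have h2 : ∑ q, w q * (glue S T).excess q = ∑ q : Quot (Glue S T),
      ((∑ x with Quot.mk (Glue S T) x = q, w (Quot.mk _ x) * ((pieceGenus S T x : ℤ) - 1)) +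
      ∑ b with Quot.mk (Glue S T) (Sum.inl (S.tgt b)) = q,
        w (Quot.mk _ (Sum.inl (S.tgt b)))) := Finset.sum_congr rfl fun q _ => h1 q
  rw [h2, Finset.sum_add_distrib]
  refine congrArg₂ (· + ·) ((Finset.sum_fiberwise Finset.univ (Quot.mk (Glue S T))
    fun x => w (Quot.mk _ x) * ((pieceGenus S T x : ℤ) - 1)).trans ?_)
    (Finset.sum_fiberwise Finset.univ (fun b => Quot.mk (Glue S T) (Sum.inl (S.tgt b)))
      fun b => w (Quot.mk _ (Sum.inl (S.tgt b))))
  rw [Fintype.sum_sum_type]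
  rfl

end gluing

/-- Genera are determined by integrating test functions against the excess. -/
theorem genus_ext {S : Surface A B} {T : Surface A C} (e : S.K ≃ T.K)
    (h : ∀ w : T.K → ℤ, ∑ k, w (e k) * S.excess k = ∑ k, w k * T.excess k) (k : S.K) :
    T.genus (e k) = S.genus k := by
  classical
  have := h (fun x => if x = e k then 1 else 0)
  simp [excess] at this
  omega

theorem glue_congr [Fintype B] {S S' : Surface A B} {T T' : Surface B C} (h : Homeo S S') (h' : Homeo T T') :
    Homeo (glue S T) (glue S' T') := by
  obtain ⟨e, h1, h2, h3⟩ := h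
  obtain ⟨f, k1, k2, k3⟩ := h'
  have hrel : ∀ x y, Glue S T x y ↔ Glue S' T' (Equiv.sumCongr e f x) (Equiv.sumCongr e f y) := by
    intro x y
    constructor
    · rintro ⟨b⟩
      simp only [Equiv.sumCongr_apply, Sum.map_inl, Sum.map_inr, h3, k2]
      exact Glue.mk b
    · intro h
      generalize hx : Equiv.sumCongr e f x = x' at h
      generalize hy : Equiv.sumCongr e f y = y' at h
      obtain ⟨b⟩ := h
      have hx2 : x = Sum.inl (S.tgt b) := by
        apply (Equiv.sumCongr e f).injective
        rw [hx]; simp [h3]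
      have hy2 : y = Sum.inr (T.src b) := by
        apply (Equiv.sumCongr e f).injective
        rw [hy]; simp [k2]
      rw [hx2, hy2]
      exact Glue.mk b
  let E : (glue S T).K ≃ (glue S' T').K := Quot.congr (Equiv.sumCongr e f) hrel
  have hEl : ∀ k, E (Quot.mk _ (Sum.inl k)) = Quot.mk _ (Sum.inl (e k)) := fun k => rfl
  have hEr : ∀ k, E (Quot.mk _ (Sum.inr k)) = Quot.mk _ (Sum.inr (f k)) := fun k => rfl
  refine ⟨E, genus_ext E ?_, ?_, ?_⟩
  · intro w
    refine (glue_sum S T (fun q => w (E q))).trans ((glue_sum S' T' w).trans ?_).symm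
    congr 1
    · congr 1
      · rw [← e.sum_comp]
        refine Finset.sum_congr rfl fun k _ => ?_
        rw [hEl, excess, excess, h1]
      · rw [← f.sum_comp]
        refine Finset.sum_congr rfl fun k _ => ?_
        rw [hEr, excess, excess, k1]
    · refine Finset.sum_congr rfl fun b _ => ?_
      rw [hEl, h3]
  · intro a
    exact (hEl _).trans (by rw [h2]; rfl)
  · intro c
    exact (hEr _).trans (by rw [k3]; rfl)

theorem cylinder_glue [Fintype A] (T : Surface A C) : Homeo (glue (cylinder A) T) T := by
  let E : (glue (cylinder A) T).K ≃ T.K :=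
    { toFun := Quot.lift (Sum.elim T.src id) (by rintro _ _ ⟨b⟩; rfl)
      invFun := fun k => Quot.mk _ (Sum.inr k)
      left_inv := by
        rintro ⟨a | k⟩
        · exact (Quot.sound (Glue.mk (S := cylinder A) (T := T) a)).symm
        · rfl
      right_inv := fun k => rfl }
  refine ⟨E, genus_ext E ?_, fun a => rfl, fun c => rfl⟩
  intro w
  refine (glue_sum (cylinder A) T (fun q => w (E q))).trans ?_
  have h1 : ∀ a : A, E (Quot.mk _ (Sum.inl a)) = T.src a := fun a => rfl
  have h2 : ∀ k, E (Quot.mk _ (Sum.inr k)) = k := fun k => rfl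
  have h3 : ∑ k : (cylinder A).K, w (E (Quot.mk _ (Sum.inl k))) * (cylinder A).excess k =
      - ∑ a : A, w (T.src a) := by
    rw [← Finset.sum_neg_distrib]
    refine Finset.sum_congr rfl fun a _ => ?_
    change w (T.src a) * _ = _
    simp [excess, cylinder]
  rw [h3]
  have h4 : ∑ b : A, w (E (Quot.mk _ (Sum.inl ((cylinder A).tgt b)))) = ∑ a : A, w (T.src a) := rfl
  rw [h4]
  simp only [h2]
  ring

theorem glue_cylinder [Fintype B] (S : Surface A B) : Homeo (glue S (cylinder B)) S := by
  let E : (glue S (cylinder B)).K ≃ S.K :=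
    { toFun := Quot.lift (Sum.elim id S.tgt) (by rintro _ _ ⟨b⟩; rfl)
      invFun := fun k => Quot.mk _ (Sum.inl k)
      left_inv := by
        rintro ⟨k | b⟩
        · rfl
        · exact Quot.sound (Glue.mk (S := S) (T := cylinder B) b)
      right_inv := fun k => rfl }
  refine ⟨E, genus_ext E ?_, fun a => rfl, fun c => rfl⟩
  intro w
  refine (glue_sum S (cylinder B) (fun q => w (E q))).trans ?_
  have h1 : ∀ b : B, E (Quot.mk _ (Sum.inr b)) = S.tgt b := fun a => rfl
  have h2 : ∀ k, E (Quot.mk _ (Sum.inl k)) = k := fun k => rfl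
  have h3 : ∑ k : (cylinder B).K, w (E (Quot.mk _ (Sum.inr k))) * (cylinder B).excess k =
      - ∑ b : B, w (S.tgt b) := by
    rw [← Finset.sum_neg_distrib]
    refine Finset.sum_congr rfl fun a _ => ?_
    change w (S.tgt a) * _ = _
    simp [excess, cylinder]
  rw [h3]
  simp only [h2]
  ring

theorem glue_assoc [Fintype B] [Fintype C] (S : Surface A B) (T : Surface B C) (U : Surface C E) :
    Homeo (glue (glue S T) U) (glue S (glue T U)) := by
  let F : (glue (glue S T) U).K → (glue S (glue T U)).K :=
    Quot.lift (Sum.elim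
      (Quot.lift (Sum.elim (fun k => Quot.mk _ (Sum.inl k))
        (fun k => Quot.mk _ (Sum.inr (Quot.mk _ (Sum.inl k)))))
        (by rintro _ _ ⟨b⟩; exact Quot.sound (Glue.mk (S := S) (T := glue T U) b)))
      (fun k => Quot.mk _ (Sum.inr (Quot.mk _ (Sum.inr k)))))
      (by
        rintro _ _ ⟨c⟩
        exact congrArg (fun z => Quot.mk _ (Sum.inr z)) (Quot.sound (Glue.mk (S := T) (T := U) c)))
  let G : (glue S (glue T U)).K → (glue (glue S T) U).K :=
    Quot.lift (Sum.elim (fun k => Quot.mk _ (Sum.inl (Quot.mk _ (Sum.inl k))))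
      (Quot.lift (Sum.elim (fun k => Quot.mk _ (Sum.inl (Quot.mk _ (Sum.inr k))))
        (fun k => Quot.mk _ (Sum.inr k)))
        (by rintro _ _ ⟨b⟩; exact Quot.sound (Glue.mk (S := glue S T) (T := U) b))))
      (by
        rintro _ _ ⟨c⟩
        exact congrArg (fun z => Quot.mk _ (Sum.inl z)) (Quot.sound (Glue.mk (S := S) (T := T) c)))
  let e : (glue (glue S T) U).K ≃ (glue S (glue T U)).K :=
    { toFun := F
      invFun := G
      left_inv := by rintro ⟨⟨⟨k | k⟩⟩ | k⟩ <;> rfl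
      right_inv := by rintro ⟨k | ⟨⟨k | k⟩⟩⟩ <;> rfl }
  refine ⟨e, genus_ext e ?_, fun a => rfl, fun c => rfl⟩
  intro w
  refine (glue_sum (glue S T) U (fun q => w (e q))).trans ((glue_sum S (glue T U) w).trans ?_).symm
  have h1 : ∑ q, w (e (Quot.mk _ (Sum.inl q))) * (glue S T).excess q =
      ∑ k, w (Quot.mk _ (Sum.inl k)) * S.excess k +
        ∑ k, w (Quot.mk _ (Sum.inr (Quot.mk _ (Sum.inl k)))) * T.excess k +
          ∑ b, w (Quot.mk _ (Sum.inl (S.tgt b))) :=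
    glue_sum S T (fun q => w (e (Quot.mk _ (Sum.inl q))))
  have h2 : ∑ q, w (Quot.mk _ (Sum.inr q)) * (glue T U).excess q =
      ∑ k, w (Quot.mk _ (Sum.inr (Quot.mk _ (Sum.inl k)))) * T.excess k +
        ∑ k, w (Quot.mk _ (Sum.inr (Quot.mk _ (Sum.inr k)))) * U.excess k +
          ∑ c, w (Quot.mk _ (Sum.inr (Quot.mk _ (Sum.inl (T.tgt c))))) :=
    glue_sum T U (fun q => w (Quot.mk _ (Sum.inr q)))
  refine (congrArg₂ (· + ·) (congrArg₂ (· + ·) rfl h2) rfl).trans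
    (Eq.symm ((congrArg₂ (· + ·) (congrArg₂ (· + ·) h1 rfl) rfl).trans ?_))
  have aux : ∀ a b c d f : ℤ, a + b + c + d + f = a + (b + d + f) + c := by intros; ring
  exact aux _ _ _ _ _

/-- The disjoint union with a closed connected surface of genus `g`. -/
def addClosed (S : Surface A B) (g : ℕ) : Surface A B where
  K := Option S.K
  genus k := k.elim g S.genus
  src a := some (S.src a)
  tgt b := some (S.tgt b)

open Classical in
/-- Remove two discs, one on the component `p` and one on the component `q`, and connect the two
holes by a tube. The components `p` and `q` are merged if they differ; otherwise a handle is
added to `p`. -/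
def tube (S : Surface A B) (p q : S.K) : Surface A B where
  K := Quot fun x y : S.K => x = p ∧ y = q
  fintypeK := Fintype.ofFinite _
  genus c := (∑ k with Quot.mk _ k = c, S.genus k) + if p = q ∧ Quot.mk _ p = c then 1 else 0
  src a := Quot.mk _ (S.src a)
  tgt b := Quot.mk _ (S.tgt b)

/-- The Euler characteristic, where a component of genus `g` with `b` boundary circles contributes
`2 - 2 * g - b`. -/
def euler [Fintype A] [Fintype B] (S : Surface A B) : ℤ :=
  (∑ k, (2 - 2 * (S.genus k : ℤ))) - Fintype.card A - Fintype.card B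

end Surface

/-- Cobordisms: surfaces up to homeomorphism relative to the boundary. -/
def Cobordism (A B : Type) : Type 1 := Quotient (Surface.setoid A B)

namespace Cobordism

variable {A B C E : Type}

def of (S : Surface A B) : Cobordism A B := Quotient.mk _ S

def comp [Fintype B] (f : Cobordism A B) (g : Cobordism B C) : Cobordism A C :=
  Quotient.map₂ Surface.glue (fun _ _ h _ _ h' => Surface.glue_congr h h') f g

theorem of_comp_of [Fintype B] (S : Surface A B) (T : Surface B C) :
    (of S).comp (of T) = of (S.glue T) := rfl

theorem id_comp [Fintype A] (f : Cobordism A B) : (of (Surface.cylinder A)).comp f = f :=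
  Quotient.inductionOn f fun S => Quotient.sound S.cylinder_glue

theorem comp_id [Fintype B] (f : Cobordism A B) : f.comp (of (Surface.cylinder B)) = f :=
  Quotient.inductionOn f fun S => Quotient.sound S.glue_cylinder

theorem assoc [Fintype B] [Fintype C] (f : Cobordism A B) (g : Cobordism B C)
    (h : Cobordism C E) : (f.comp g).comp h = f.comp (g.comp h) :=
  Quotient.inductionOn₃ f g h fun S T U => Quotient.sound (S.glue_assoc T U)

end Cobordism

/-! ### The linear category of cobordisms modulo the local relations -/

section linear

variable (R : Type u) [CommRing R] {A B C E : Type}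

/-- Formal `R`-linear combinations of cobordisms. -/
abbrev Combo (A B : Type) := Cobordism A B →₀ R

/-- The surface `S` as a formal combination. -/
def surf (S : Surface A B) : Combo R A B := Finsupp.single (Cobordism.of S) 1

variable {R} in
/-- Bilinear extension of the composition of cobordisms. -/
def comboComp [Fintype B] : Combo R A B →ₗ[R] Combo R B C →ₗ[R] Combo R A C :=
  Finsupp.lsum R fun f =>
    (LinearMap.lsmul R (Combo R B C →ₗ[R] Combo R A C)).flip (Finsupp.lmapDomain R R f.comp)

theorem comboComp_single [Fintype B] (f : Cobordism A B) (g : Cobordism B C) (r s : R) :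
    comboComp (Finsupp.single f r) (Finsupp.single g s) = Finsupp.single (f.comp g) (r * s) := by
  simp [comboComp, Finsupp.mapDomain_single]

theorem comboComp_assoc [Fintype B] [Fintype C] (f : Combo R A B) (g : Combo R B C)
    (h : Combo R C E) : comboComp (comboComp f g) h = comboComp f (comboComp g h) := by
  induction f using Finsupp.induction_linear with
  | zero => simp
  | add f f' hf hf' => simp [hf, hf']
  | single f r =>
    induction g using Finsupp.induction_linear with
    | zero => simp
    | add f f' hf hf' => simp [hf, hf']
    | single g s =>
      induction h using Finsupp.induction_linear with
      | zero => simp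
      | add f f' hf hf' => simp [hf, hf']
      | single h t => simp only [comboComp_single, Cobordism.assoc, mul_assoc]

theorem comboComp_id [Fintype B] (f : Combo R A B) :
    comboComp f (surf R (Surface.cylinder B)) = f := by
  induction f using Finsupp.induction_linear with
  | zero => simp
  | add f f' hf hf' => simp [hf, hf']
  | single f r => simp only [surf, comboComp_single, Cobordism.comp_id, mul_one]

theorem id_comboComp [Fintype A] (f : Combo R A B) :
    comboComp (surf R (Surface.cylinder A)) f = f := by
  induction f using Finsupp.induction_linear with
  | zero => simp
  | add f f' hf hf' => simp [hf, hf']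
  | single f r => simp only [surf, comboComp_single, Cobordism.id_comp, one_mul]

/-- The local relations: a sphere component is zero, a torus component is `2`, and for any four
discs `1, 2, 3, 4` on a surface (on the components `p`, `q`, `r`, `s`),
`C₁₂ + C₃₄ = C₁₃ + C₂₄`, where `Cᵢⱼ` has the discs `i` and `j` replaced by a tube. -/
inductive LocalRel : Combo R A B → Prop
  | sphere (S : Surface A B) : LocalRel (surf R (S.addClosed 0))
  | torus (S : Surface A B) : LocalRel (surf R (S.addClosed 1) - (2 : R) • surf R S)
  | fourTube (S : Surface A B) (p q r s : S.K) :
      LocalRel (surf R (S.tube p q) + surf R (S.tube r s) -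
        surf R (S.tube p r) - surf R (S.tube q s))

/-- The two-sided ideal generated by the local relations. -/
def relIdeal (A B : Type) [Fintype A] [Fintype B] : Submodule R (Combo R A B) :=
  Submodule.span R {x | ∃ (A' B' : Type) (_ : Fintype A') (_ : Fintype B')
    (f : Combo R A A') (y : Combo R A' B') (g : Combo R B' B),
    LocalRel R y ∧ x = comboComp (comboComp f y) g}

theorem comp_mem_relIdeal [Fintype A] [Fintype B] [Fintype C] (f : Combo R A B)
    {x : Combo R B C} (hx : x ∈ relIdeal R B C) : comboComp f x ∈ relIdeal R A C := by
  induction hx using Submodule.span_induction with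
  | mem x h =>
    obtain ⟨A', B', i1, i2, g, y, h, hy, rfl⟩ := h
    refine Submodule.subset_span ⟨A', B', i1, i2, comboComp f g, y, h, hy, ?_⟩
    simp only [comboComp_assoc]
  | zero => simp
  | add x y _ _ hx hy => simpa using add_mem hx hy
  | smul a x _ hx => simpa using Submodule.smul_mem _ a hx

theorem mem_relIdeal_comp [Fintype A] [Fintype B] [Fintype C] {x : Combo R A B}
    (hx : x ∈ relIdeal R A B) (f : Combo R B C) : comboComp x f ∈ relIdeal R A C := by
  induction hx using Submodule.span_induction with
  | mem x h =>
    obtain ⟨A', B', i1, i2, g, y, h, hy, rfl⟩ := h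
    refine Submodule.subset_span ⟨A', B', i1, i2, g, y, comboComp h f, hy, ?_⟩
    simp only [comboComp_assoc]
  | zero => simp
  | add x y _ _ hx hy => simpa using add_mem hx hy
  | smul a x _ hx => simpa using Submodule.smul_mem _ a hx

end linear

/-- An object of the cobordism category over `R`: a finite collection of circles, together with
a formal degree shift. -/
structure Cob (R : Type u) : Type 1 where
  circles : Type
  [fintypeCircles : Fintype circles]
  shift : ℤ

namespace Cob

attribute [instance] Cob.fintypeCircles

variable {R : Type u} [CommRing R]

/-- Morphisms are combinations of cobordisms modulo the local relations; the shifts only matter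
for the degree of a morphism. -/
def Hom (X Y : Cob R) := Combo R X.circles Y.circles ⧸ relIdeal R X.circles Y.circles

instance (X Y : Cob R) : AddCommGroup (Hom X Y) :=
  inferInstanceAs (AddCommGroup (_ ⧸ relIdeal R X.circles Y.circles))

instance (X Y : Cob R) : Module R (Hom X Y) :=
  inferInstanceAs (Module R (_ ⧸ relIdeal R X.circles Y.circles))

def cls (X Y : Cob R) : Combo R X.circles Y.circles →ₗ[R] Hom X Y :=
  (relIdeal R X.circles Y.circles).mkQ

theorem cls_surjective (X Y : Cob R) : Function.Surjective (cls X Y) :=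
  Submodule.mkQ_surjective _

theorem cls_eq_zero {X Y : Cob R} {x : Combo R X.circles Y.circles} :
    cls X Y x = 0 ↔ x ∈ relIdeal R X.circles Y.circles :=
  Submodule.Quotient.mk_eq_zero _

def comp (X Y Z : Cob R) : Hom X Y →ₗ[R] Hom Y Z →ₗ[R] Hom X Z :=
  Submodule.liftQ _
    (LinearMap.flip <| Submodule.liftQ _
      (LinearMap.compr₂ (comboComp (R := R)) (cls X Z)).flip
      (fun y hy => by
        refine LinearMap.ext fun f => ?_
        exact cls_eq_zero.2 (comp_mem_relIdeal R f hy)))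
    (fun x hx => by
      ext1 y
      obtain ⟨y, rfl⟩ := cls_surjective Y Z y
      exact cls_eq_zero.2 (mem_relIdeal_comp R hx y))

theorem comp_cls (X Y Z : Cob R) (f : Combo R X.circles Y.circles)
    (g : Combo R Y.circles Z.circles) :
    comp X Y Z (cls X Y f) (cls Y Z g) = cls X Z (comboComp f g) := rfl

instance : Category (Cob R) where
  Hom := Hom
  id X := cls X X (surf R (Surface.cylinder X.circles))
  comp f g := comp _ _ _ f g
  id_comp {X Y} f := by
    obtain ⟨f, rfl⟩ := cls_surjective X Y f
    rw [comp_cls, id_comboComp]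
  comp_id {X Y} f := by
    obtain ⟨f, rfl⟩ := cls_surjective X Y f
    rw [comp_cls, comboComp_id]
  assoc {W X Y Z} f g h := by
    obtain ⟨f, rfl⟩ := cls_surjective W X f
    obtain ⟨g, rfl⟩ := cls_surjective X Y g
    obtain ⟨h, rfl⟩ := cls_surjective Y Z h
    simp only [comp_cls, comboComp_assoc]

instance : Preadditive (Cob R) where
  homGroup X Y := inferInstanceAs (AddCommGroup (Hom X Y))
  add_comp X Y Z f f' g := LinearMap.map_add₂ (comp X Y Z) f f' g
  comp_add X Y Z f g g' := LinearMap.map_add (comp X Y Z f) g g'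

instance : Linear R (Cob R) where
  homModule X Y := inferInstanceAs (Module R (Hom X Y))
  smul_comp X Y Z r f g := LinearMap.map_smul₂ (comp X Y Z) r f g
  comp_smul X Y Z f r g := LinearMap.map_smul (comp X Y Z f) r g

/-- The class of a surface. -/
def ofSurface {X Y : Cob R} (S : Surface X.circles Y.circles) : X ⟶ Y := cls X Y (surf R S)

theorem ofSurface_comp {X Y Z : Cob R} (S : Surface X.circles Y.circles)
    (T : Surface Y.circles Z.circles) :
    ofSurface S ≫ ofSurface T = (ofSurface (S.glue T) : X ⟶ Z) := by
  change comp X Y Z (cls X Y (surf R S)) (cls Y Z (surf R T)) = _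
  rw [comp_cls, surf, surf, comboComp_single, mul_one]
  rfl

theorem ofSurface_eq {X Y : Cob R} {S T : Surface X.circles Y.circles} (h : S.Homeo T) :
    (ofSurface S : X ⟶ Y) = ofSurface T := by
  unfold ofSurface surf Cobordism.of
  rw [Quotient.sound h]

/-- The morphisms of degree `d`. A surface has its Euler characteristic as its degree, corrected
by the difference of the shifts. -/
def degreePart (X Y : Cob R) (d : ℤ) : Submodule R (X ⟶ Y) :=
  Submodule.span R {f | ∃ S : Surface X.circles Y.circles,
    S.euler + Y.shift - X.shift = d ∧ f = ofSurface S}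

/-- A matrix of morphisms is of degree `0` if all of its entries are. -/
def MatDegreeZero {M N : Mat_ (Cob R)} (f : M ⟶ N) : Prop :=
  ∀ i j, f i j ∈ degreePart (M.X i) (N.X j) 0

/-- The empty collection of circles, with a degree shift. -/
abbrev empty (R : Type u) (m : ℤ) : Cob R := ⟨Empty, m⟩

end Cob

/-! ### Link diagrams -/

/-- Which ends of a crossing are incoming, for ends numbered counterclockwise from the incoming end
of the lower strand: the upper strand runs from `3` to `1` at a positive crossing and from `1` to
`3` at a negative one. -/
def incomingEnd (positive : Bool) : Fin 4 → Bool := ![true, !positive, false, positive]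

/-- A diagram of an oriented link in the plane, up to planar isotopy, given by a planar rotation
system. At the crossing `c` the four ends are `(c, 0), …, (c, 3)` in counterclockwise order,
starting with the incoming end of the lower strand; so `0, 2` belong to the lower and `1, 3` to the
upper strand. The involution `edge` matches the ends that are joined by an arc of the diagram, and
`loops` is the number of components without crossings. -/
structure LinkDiagram where
  crossings : ℕ
  loops : ℕ
  edge : Fin crossings × Fin 4 → Fin crossings × Fin 4
  edge_edge : ∀ d, edge (edge d) = d
  positive : Fin crossings → Bool
  /-- Every arc joins an outgoing end and an incoming end. -/
  oriented : ∀ d, incomingEnd (positive (edge d).1) (edge d).2 = !incomingEnd (positive d.1) d.2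
  /-- Euler's formula `V - E + F = 2 C` for the underlying four-valent graph, whose faces are the
  orbits of "cross the arc, then rotate counterclockwise". It says that every connected component
  of the graph lies on a sphere. -/
  planar : (crossings : ℤ) - 2 * crossings +
      Nat.card (Quot fun d e : Fin crossings × Fin 4 => e = ((edge d).1, (edge d).2 + 1)) =
    2 * Nat.card (Quot fun d e : Fin crossings × Fin 4 => e = edge d ∨ e = (d.1, d.2 + 1))

namespace LinkDiagram

variable (D : LinkDiagram)

/-- The ends of arcs at crossings. -/
abbrev End := Fin D.crossings × Fin 4

/-- The pieces from which the circles of a smoothing are assembled: the ends of arcs and the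
crossingless components. -/
abbrev Piece := D.End ⊕ Fin D.loops

/-- The vertices of the cube: a choice of smoothing (`false` for the 0-smoothing) at every
crossing. -/
abbrev Vertex := Fin D.crossings → Bool

/-- The 0-smoothing joins the ends `0, 1` and `2, 3` of a crossing, the 1-smoothing joins `0, 3`
and `1, 2`. -/
def mate : Bool → Fin 4 → Fin 4
  | false => ![1, 0, 3, 2]
  | true => ![3, 2, 1, 0]

def smooth (v : D.Vertex) (d : D.End) : D.End := (d.1, mate (v d.1) d.2)

/-- Two pieces are joined directly by an arc of the diagram or by an arc of the smoothing `v`. -/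
inductive Joined (v : D.Vertex) : D.Piece → D.Piece → Prop
  | edge (d : D.End) : Joined v (Sum.inl d) (Sum.inl (D.edge d))
  | smooth (d : D.End) : Joined v (Sum.inl d) (Sum.inl (D.smooth v d))

/-- The circles of the smoothing `v`. -/
abbrev Circles (v : D.Vertex) : Type := Quot (D.Joined v)

open Classical in
instance (v : D.Vertex) : Fintype (D.Circles v) := Fintype.ofFinite _

/-- The components of the saddle cobordism between smoothings `v` and `w`. -/
abbrev SaddlePieces (v w : D.Vertex) : Type := Quot fun x y => D.Joined v x y ∨ D.Joined w x y

open Classical in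
instance (v w : D.Vertex) : Fintype (D.SaddlePieces v w) := Fintype.ofFinite _

/-- For smoothings that differ at one crossing: the saddle at that crossing, with cylinders
elsewhere. Circles belong to the same component when they are joined by arcs of `v` and `w`, and all
components have genus zero. -/
def saddle (v w : D.Vertex) : Surface (D.Circles v) (D.Circles w) where
  K := D.SaddlePieces v w
  genus _ := 0
  src := Quot.map id fun _ _ => Or.inl
  tgt := Quot.map id fun _ _ => Or.inr

/-- The number of 1-smoothings. -/
def height (v : D.Vertex) : ℕ := (Finset.univ.filter fun c => v c = true).card

def nPlus : ℕ := (Finset.univ.filter fun c => D.positive c = true).card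

def nMinus : ℕ := (Finset.univ.filter fun c => D.positive c = false).card

/-! #### Planar diagrams have a checkerboard colouring -/

section checkerboard

abbrev Face := Quot fun d e : D.End => e = ((D.edge d).1, (D.edge d).2 + 1)

abbrev Component := Quot fun d e : D.End => e = D.edge d ∨ e = (d.1, d.2 + 1)

def outgoing (d : D.End) : Bool := !incomingEnd (D.positive d.1) d.2

theorem outgoing_edge (d : D.End) : D.outgoing (D.edge d) = !D.outgoing d := by
  simp only [outgoing, D.oriented d]

theorem sum_outgoing {M : Type*} [AddCommMonoid M] (f : D.End → M) :
    ∑ d : {d // D.outgoing d = true}, (f d.1 + f (D.edge d.1)) = ∑ d, f d := by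
  rw [Finset.sum_add_distrib]
  rw [← Fintype.sum_subtype_add_sum_subtype (fun d => D.outgoing d = true) f]
  congr 1
  let F : {d // D.outgoing d = true} → {d // ¬ D.outgoing d = true} :=
    fun d => ⟨D.edge d.1, by rw [outgoing_edge, d.2]; simp⟩
  refine Fintype.sum_bijective F ⟨?_, ?_⟩ _ _ fun d => rfl
  · intro d e h
    have : D.edge (D.edge d.1) = D.edge (D.edge e.1) := congrArg (fun z => D.edge z.1) h
    rw [D.edge_edge, D.edge_edge] at this
    exact Subtype.ext this
  · intro d
    refine ⟨⟨D.edge d.1, ?_⟩, Subtype.ext (D.edge_edge _)⟩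
    rw [outgoing_edge]
    simpa using d.2

theorem card_outgoing : Fintype.card {d // D.outgoing d = true} = 2 * D.crossings := by
  have h := D.sum_outgoing fun _ => (1 : ℕ)
  simp at h
  omega

abbrev F₂ := ZMod 2

/-- Each face function gives its coboundary on arcs. -/
def faceMap : (D.Face → F₂) →ₗ[F₂] ({d // D.outgoing d = true} → F₂) where
  toFun s d := s (Quot.mk _ d.1) + s (Quot.mk _ (D.edge d.1))
  map_add' s t := by ext; simp; ring
  map_smul' a s := by ext; simp; ring

def incidence : Matrix {d // D.outgoing d = true} (Fin D.crossings) F₂ :=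
  Matrix.of fun d c => (if d.1.1 = c then 1 else 0) + (if (D.edge d.1).1 = c then 1 else 0)

theorem incidence_mulVec (t : Fin D.crossings → F₂) (d : {d // D.outgoing d = true}) :
    (D.incidence.mulVec t) d = t d.1.1 + t (D.edge d.1).1 := by
  simp [incidence, Matrix.mulVec, dotProduct, add_mul, Finset.sum_add_distrib]

theorem incidence_vecMul (f : {d // D.outgoing d = true} → F₂) (c : Fin D.crossings) :
    (Matrix.vecMul f D.incidence) c = ∑ d, f d * ((if d.1.1 = c then 1 else 0) +
      (if (D.edge d.1).1 = c then 1 else 0)) := rfl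

theorem finrank_ker_faceMap : Module.finrank F₂ (LinearMap.ker D.faceMap) ≤ Nat.card D.Component := by
  classical
  have hconst : ∀ s ∈ LinearMap.ker D.faceMap, ∀ d e : D.End,
      (Quot.mk _ d : D.Component) = Quot.mk _ e → s (Quot.mk _ d) = s (Quot.mk _ e) := by
    intro s hs
    have hedge : ∀ d, s (Quot.mk _ (D.edge d)) = s (Quot.mk _ d) := by
      intro d
      have key : ∀ d, D.outgoing d = true → s (Quot.mk _ (D.edge d)) = s (Quot.mk _ d) := by
        intro d hd
        have h0 : s (Quot.mk _ d) + s (Quot.mk _ (D.edge d)) = 0 :=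
          congrFun (LinearMap.mem_ker.1 hs) ⟨d, hd⟩
        exact (CharTwo.add_eq_zero.1 h0).symm
      cases hd : D.outgoing d
      · have := key (D.edge d) (by rw [outgoing_edge, hd]; rfl)
        rw [D.edge_edge] at this
        exact this.symm
      · exact key d hd
    have hface : ∀ d : D.End, (Quot.mk _ ((D.edge d).1, (D.edge d).2 + 1) : D.Face) = Quot.mk _ d := by
      intro d
      refine (Quot.sound ?_).symm
      rfl
    have hrot : ∀ d : D.End, s (Quot.mk _ (d.1, d.2 + 1)) = s (Quot.mk _ d) := by
      intro d
      have := hface (D.edge d)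
      rw [D.edge_edge] at this
      rw [this, hedge]
    intro d e h
    have h2 := congrArg (Quot.lift (fun d : D.End => s (Quot.mk _ d)) (by
      rintro a b (rfl | rfl)
      · exact (hedge a).symm
      · exact (hrot a).symm)) h
    exact h2
  have hfin : Fintype D.Component := Fintype.ofFinite _
  let ev : LinearMap.ker D.faceMap →ₗ[F₂] (D.Component → F₂) :=
    { toFun := fun s c => s.1 (Quot.mk _ (Quot.out c))
      map_add' := fun s t => rfl
      map_smul' := fun a s => rfl }
  have hinj : Function.Injective ev := by
    intro s t h
    refine Subtype.ext (funext fun f => ?_)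
    induction f using Quot.ind with
    | _ d =>
      have h1 := congrFun h (Quot.mk _ d)
      have h2 : (Quot.mk _ (Quot.out (Quot.mk _ d : D.Component)) : D.Component) = Quot.mk _ d :=
        Quot.out_eq _
      exact (hconst _ s.2 _ _ h2).symm.trans (h1.trans (hconst _ t.2 _ _ h2))
  have := LinearMap.finrank_le_finrank_of_injective hinj
  rwa [Module.finrank_fintype_fun_eq_card, ← Nat.card_eq_fintype_card] at this

theorem finrank_ker_incidence :
    Module.finrank F₂ (LinearMap.ker D.incidence.mulVecLin) ≤ Nat.card D.Component := by
  classical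
  have hconst : ∀ t ∈ LinearMap.ker D.incidence.mulVecLin, ∀ d e : D.End,
      (Quot.mk _ d : D.Component) = Quot.mk _ e → t d.1 = t e.1 := by
    intro t ht
    have hedge : ∀ d, t (D.edge d).1 = t d.1 := by
      intro d
      have key : ∀ d, D.outgoing d = true → t (D.edge d).1 = t d.1 := by
        intro d hd
        have h0 : D.incidence.mulVec t ⟨d, hd⟩ = 0 := congrFun (LinearMap.mem_ker.1 ht) ⟨d, hd⟩
        rw [incidence_mulVec] at h0
        exact (CharTwo.add_eq_zero.1 h0).symm
      cases hd : D.outgoing d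
      · have := key (D.edge d) (by rw [outgoing_edge, hd]; rfl)
        rw [D.edge_edge] at this
        exact this.symm
      · exact key d hd
    intro d e h
    exact congrArg (Quot.lift (fun d : D.End => t d.1) (by
      rintro a b (rfl | rfl)
      · exact (hedge a).symm
      · rfl)) h
  have hfin : Fintype D.Component := Fintype.ofFinite _
  let ev : LinearMap.ker D.incidence.mulVecLin →ₗ[F₂] (D.Component → F₂) :=
    { toFun := fun t c => t.1 (Quot.out c).1
      map_add' := fun s t => rfl
      map_smul' := fun a s => rfl }
  have hinj : Function.Injective ev := by
    intro s t h
    refine Subtype.ext (funext fun c => ?_)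
    have h1 := congrFun h (Quot.mk _ (c, 0))
    have h2 : (Quot.mk _ (Quot.out (Quot.mk _ (c, 0) : D.Component)) : D.Component) =
        Quot.mk _ (c, 0) := Quot.out_eq _
    exact (hconst _ s.2 _ _ h2).symm.trans (h1.trans (hconst _ t.2 _ _ h2))
  have := LinearMap.finrank_le_finrank_of_injective hinj
  rwa [Module.finrank_fintype_fun_eq_card, ← Nat.card_eq_fintype_card] at this

theorem incidence_faceMap (s : D.Face → F₂) : Matrix.vecMul (D.faceMap s) D.incidence = 0 := by
  funext c
  rw [incidence_vecMul]
  let g : D.End → F₂ := fun d => (s (Quot.mk _ d) + s (Quot.mk _ (D.edge d))) *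
    (if d.1 = c then 1 else 0)
  have h1 : ∀ d : {d // D.outgoing d = true}, D.faceMap s d * ((if d.1.1 = c then 1 else 0) +
      (if (D.edge d.1).1 = c then 1 else 0)) = g d.1 + g (D.edge d.1) := by
    intro d
    simp only [g, D.edge_edge]
    change (s _ + s _) * _ = _
    ring
  rw [Finset.sum_congr rfl fun d _ => h1 d, D.sum_outgoing g]
  let rot : D.End ≃ D.End := Equiv.prodCongr (Equiv.refl _) (Equiv.addRight 1)
  have hface : ∀ d : D.End, (Quot.mk _ (D.edge d) : D.Face) = Quot.mk _ (rot d) := by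
    intro d
    refine Quot.sound ?_
    rw [D.edge_edge]
    rfl
  have h2 : ∑ d, s (Quot.mk _ (D.edge d)) * (if d.1 = c then (1 : F₂) else 0) =
      ∑ d, s (Quot.mk _ d) * (if d.1 = c then (1 : F₂) else 0) := by
    rw [← rot.sum_comp (fun d => s (Quot.mk _ d) * (if d.1 = c then (1 : F₂) else 0))]
    refine Finset.sum_congr rfl fun d _ => ?_
    rw [hface]
    rfl
  simp only [g, add_mul, Finset.sum_add_distrib]
  rw [h2]
  exact CharTwo.add_self_eq_zero _

theorem incidence_one : Matrix.vecMul (fun _ => 1) D.incidence = 0 := by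
  funext c
  rw [incidence_vecMul]
  simp only [one_mul]
  rw [D.sum_outgoing fun d => if d.1 = c then (1 : F₂) else 0, Fintype.sum_prod_type]
  refine Finset.sum_eq_zero fun x _ => ?_
  refine (Finset.sum_const (s := Finset.univ) (if x = c then (1 : F₂) else 0)).trans ?_
  split_ifs <;> decide

theorem one_mem_range_faceMap : (fun _ => 1) ∈ LinearMap.range D.faceMap := by
  classical
  have hfin : Fintype D.Face := Fintype.ofFinite _
  have hle : LinearMap.range D.faceMap ≤ LinearMap.ker D.incidence.vecMulLinear := by
    rintro _ ⟨s, rfl⟩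
    exact D.incidence_faceMap s
  have h1 := D.faceMap.finrank_range_add_finrank_ker
  have h2 := D.incidence.mulVecLin.finrank_range_add_finrank_ker
  have h3 := D.incidence.vecMulLinear.finrank_range_add_finrank_ker
  have h4 : Module.finrank F₂ (LinearMap.range D.incidence.vecMulLinear) =
      Module.finrank F₂ (LinearMap.range D.incidence.mulVecLin) := by
    rw [← Matrix.mulVecLin_transpose]
    exact D.incidence.rank_transpose
  rw [Module.finrank_fintype_fun_eq_card] at h1 h2 h3
  rw [D.card_outgoing] at h3
  rw [Fintype.card_fin] at h2
  rw [← Nat.card_eq_fintype_card] at h1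
  have h5 := D.finrank_ker_faceMap
  have h6 := D.finrank_ker_incidence
  have h7 := D.planar
  change (D.crossings : ℤ) - 2 * D.crossings + Nat.card D.Face = 2 * Nat.card D.Component at h7
  have h8 := Submodule.eq_of_le_of_finrank_le hle (by omega)
  rw [h8]
  exact D.incidence_one

theorem exists_checkerboard : ∃ col : D.End → Bool, (∀ d, col (D.edge d) = !col d) ∧
    ∀ d : D.End, col (d.1, d.2 + 1) = !col d := by
  obtain ⟨s, hs⟩ := D.one_mem_range_faceMap
  have hne : ∀ d, s (Quot.mk _ (D.edge d)) ≠ s (Quot.mk _ d) := by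
    intro d
    have key : ∀ d, D.outgoing d = true → s (Quot.mk _ d) + s (Quot.mk _ (D.edge d)) = 1 :=
      fun d hd => congrFun hs ⟨d, hd⟩
    intro h
    cases hd : D.outgoing d
    · have := key (D.edge d) (by rw [outgoing_edge, hd]; rfl)
      rw [D.edge_edge, h, CharTwo.add_self_eq_zero] at this
      exact zero_ne_one this
    · have := key d hd
      rw [h, CharTwo.add_self_eq_zero] at this
      exact zero_ne_one this
  have hbool : ∀ a b : F₂, a ≠ b → decide (a = 1) = !decide (b = 1) := by decide
  refine ⟨fun d => decide (s (Quot.mk _ d) = 1), fun d => hbool _ _ (hne d), fun d => ?_⟩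
  refine hbool _ _ ?_
  have hface : (Quot.mk _ (d.1, d.2 + 1) : D.Face) = Quot.mk _ (D.edge d) := by
    refine (Quot.sound ?_).symm
    rw [D.edge_edge]
  rw [hface]
  exact hne d

end checkerboard

/-! #### A saddle merges two circles or splits one circle -/

section saddles

theorem not_sameCycle_of_period {α : Type*} [Finite α] {h : Equiv.Perm α} {a b : α} {k : ℕ}
    (hk : 0 < k) (hab : a ≠ b) (hper : (h ^ k) a = a) (hmin : ∀ i, 0 < i → i < k → (h ^ i) a ≠ b) :
    ¬ h.SameCycle a b := by
  intro hs
  obtain ⟨j, hj⟩ := hs.exists_nat_pow_eq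
  have hp : Function.IsPeriodicPt h k a := by
    rw [Function.IsPeriodicPt, Function.IsFixedPt, ← Equiv.Perm.coe_pow]
    exact hper
  have hm : (h ^ (j % k)) a = b := by
    rw [Equiv.Perm.coe_pow, hp.iterate_mod_apply, ← Equiv.Perm.coe_pow]
    exact hj
  rcases Nat.eq_zero_or_pos (j % k) with h0 | h0
  · rw [h0] at hm
    exact hab hm
  · exact hmin _ h0 (Nat.mod_lt _ hk) hm

theorem sameCycle_swap {α : Type*} [Finite α] [DecidableEq α] {f g : Equiv.Perm α} {a b : α}
    (hab : a ≠ b) (p : α → Prop) (ha : p a) (hf : ∀ d, p d → p (f d))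
    (hg : ∀ d, p d → g d = Equiv.swap a b (f d)) : g.SameCycle a b ↔ ¬ f.SameCycle a b := by
  classical
  have hex : ∃ k, 0 < k ∧ ((f ^ k) a = a ∨ (f ^ k) a = b) := by
    have := isOfFinOrder_of_finite f
    exact ⟨orderOf f, this.orderOf_pos, Or.inl (by rw [pow_orderOf_eq_one]; rfl)⟩
  obtain ⟨hk, hor⟩ := Nat.find_spec hex
  set k := Nat.find hex
  have hmin : ∀ i, 0 < i → i < k → (f ^ i) a ≠ a ∧ (f ^ i) a ≠ b := by
    intro i h0 hi
    have := Nat.find_min hex hi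
    tauto
  have hp : ∀ i, p ((f ^ i) a) := by
    intro i
    induction i with
    | zero => exact ha
    | succ i ih => rw [pow_succ', Equiv.Perm.mul_apply]; exact hf _ ih
  have hlt : ∀ i, i < k → (g ^ i) a = (f ^ i) a := by
    intro i
    induction i with
    | zero => intro _; rfl
    | succ i ih =>
      intro hi
      rw [pow_succ', Equiv.Perm.mul_apply, ih (by omega), hg _ (hp i), ← Equiv.Perm.mul_apply f,
        ← pow_succ']
      obtain ⟨h1, h2⟩ := hmin (i + 1) (by omega) hi
      exact Equiv.swap_apply_of_ne_of_ne h1 h2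
  have hgk : (g ^ k) a = Equiv.swap a b ((f ^ k) a) := by
    obtain ⟨m, hm⟩ : ∃ m, k = m + 1 := ⟨k - 1, by omega⟩
    rw [hm, pow_succ', Equiv.Perm.mul_apply, hlt m (by omega), hg _ (hp m),
      ← Equiv.Perm.mul_apply f, ← pow_succ']
  rcases hor with h | h
  · rw [h, Equiv.swap_apply_left] at hgk
    have h1 : ¬ f.SameCycle a b :=
      not_sameCycle_of_period hk hab h fun i h0 hi => (hmin i h0 hi).2
    exact ⟨fun _ => h1, fun _ => ⟨k, by simpa using hgk⟩⟩
  · rw [h, Equiv.swap_apply_right] at hgk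
    have h1 : ¬ g.SameCycle a b :=
      not_sameCycle_of_period hk hab hgk fun i h0 hi => by
        rw [hlt i hi]; exact (hmin i h0 hi).2
    exact ⟨fun h2 => absurd h2 h1, fun h2 => absurd ⟨k, by simpa using h⟩ h2⟩

variable {D}

theorem mate_mate (b : Bool) (i : Fin 4) : mate b (mate b i) = i := by
  revert b i; decide

theorem smooth_smooth (v : D.Vertex) (d : D.End) : D.smooth v (D.smooth v d) = d := by
  simp [smooth, mate_mate]

/-- Follow an arc of the diagram and then an arc of the smoothing. -/
def walk (v : D.Vertex) : Equiv.Perm D.End where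
  toFun d := D.smooth v (D.edge d)
  invFun d := D.edge (D.smooth v d)
  left_inv d := by simp only [smooth_smooth, D.edge_edge]
  right_inv d := by simp only [smooth_smooth, D.edge_edge]

theorem col_smooth {col : D.End → Bool} (hrot : ∀ d : D.End, col (d.1, d.2 + 1) = !col d)
    (v : D.Vertex) (d : D.End) : col (D.smooth v d) = !col d := by
  obtain ⟨c, i⟩ := d
  have h0 := hrot (c, 0)
  have h1 := hrot (c, 1)
  have h2 := hrot (c, 2)
  have h3 := hrot (c, 3)
  simp only [Fin.isValue, zero_add, Fin.reduceAdd] at h0 h1 h2 h3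
  unfold smooth mate
  cases v c <;> fin_cases i <;> simp [h0, h1, h2]

theorem joined_iff_sameCycle {col : D.End → Bool} (hedge : ∀ d, col (D.edge d) = !col d)
    (hrot : ∀ d : D.End, col (d.1, d.2 + 1) = !col d) (v : D.Vertex) (a b : D.End)
    (hab : col a = col b) :
    (Quot.mk _ (Sum.inl a) : D.Circles v) = Quot.mk _ (Sum.inl b) ↔ (walk v).SameCycle a b := by
  constructor
  · intro h
    have h := Quot.eqvGen_exact h
    let rep : D.End → D.End := fun d => if col d = col a then d else D.edge d
    have hrep : ∀ x y, D.Joined v x y → ∀ d e, x = Sum.inl d → y = Sum.inl e →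
        (walk v).SameCycle (rep d) (rep e) := by
      rintro _ _ (d | d) d' e' h1 h2
      · obtain rfl := Sum.inl_injective h1
        obtain rfl := Sum.inl_injective h2
        have : rep (D.edge d) = rep d := by
          simp only [rep, hedge, D.edge_edge]
          cases col d <;> cases col a <;> simp
        rw [this]
      · obtain rfl := Sum.inl_injective h1
        obtain rfl := Sum.inl_injective h2
        simp only [rep, col_smooth hrot]
        have h3 : ∀ d, (walk v).SameCycle (D.edge (D.smooth v d)) d := by
          intro d
          refine ⟨1, ?_⟩
          simp [walk, D.edge_edge, smooth_smooth]
        by_cases hd : col d = col a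
        · have : ¬ (!col d) = col a := by rw [hd]; simp
          rw [if_pos hd, if_neg this]
          exact (h3 d).symm
        · have : (!col d) = col a := by
            revert hd; cases col d <;> cases col a <;> simp
          rw [if_neg hd, if_pos this]
          have := h3 (D.smooth v d)
          rwa [smooth_smooth] at this
    let P : D.Piece → Prop := fun x => ∃ d, x = Sum.inl d ∧ (walk v).SameCycle a (rep d)
    have hP : ∀ x y, Relation.EqvGen (D.Joined v) x y → (P x ↔ P y) := by
      intro x y h
      induction h with
      | rel x y h =>
        have hh := hrep x y h
        constructor
        · rintro ⟨d, rfl, hd⟩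
          obtain ⟨e, rfl⟩ : ∃ e, y = Sum.inl e := by cases h <;> exact ⟨_, rfl⟩
          exact ⟨e, rfl, hd.trans (hh d e rfl rfl)⟩
        · rintro ⟨e, rfl, he⟩
          obtain ⟨d, rfl⟩ : ∃ d, x = Sum.inl d := by
            generalize hy : (Sum.inl e : D.Piece) = y at h
            cases h <;> exact ⟨_, rfl⟩
          exact ⟨d, rfl, he.trans (hh d e rfl rfl).symm⟩
      | refl x => rfl
      | symm x y _ ih => exact ih.symm
      | trans x y z _ _ ih1 ih2 => exact ih1.trans ih2
    have ha : P (Sum.inl a) := ⟨a, rfl, by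
      rw [show rep a = a from if_pos rfl]⟩
    obtain ⟨d, hd, hs⟩ := (hP _ _ h).1 ha
    obtain rfl := Sum.inl_injective hd
    simpa [rep, hab] using hs
  · intro h
    obtain ⟨j, rfl⟩ := h.exists_nat_pow_eq
    clear h hab
    induction j with
    | zero => rfl
    | succ j ih =>
      rw [ih, pow_succ', Equiv.Perm.mul_apply]
      exact (Quot.sound (Joined.edge _)).trans (Quot.sound (Joined.smooth _))

theorem circles_dichotomy (v w : D.Vertex) (c : Fin D.crossings) (hc : v c = false)
    (hw : w = Function.update v c true) :
    ((Quot.mk _ (Sum.inl (c, 0)) : D.Circles w) = Quot.mk _ (Sum.inl (c, 2))) ↔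
    ¬ ((Quot.mk _ (Sum.inl (c, 0)) : D.Circles v) = Quot.mk _ (Sum.inl (c, 2))) := by
  subst hw
  obtain ⟨col, hedge, hrot⟩ := D.exists_checkerboard
  have h0 := hrot (c, 0)
  have h1 := hrot (c, 1)
  have h2 := hrot (c, 2)
  simp only [Fin.isValue, zero_add, Fin.reduceAdd] at h0 h1 h2
  have hcol : col (c, 0) = col (c, 2) := by rw [h1, h0]; simp
  rw [joined_iff_sameCycle hedge hrot _ _ _ hcol, joined_iff_sameCycle hedge hrot _ _ _ hcol]
  refine sameCycle_swap (by simp) (fun d => col d = col (c, 0)) rfl ?_ ?_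
  · intro d hd
    change col (D.smooth v (D.edge d)) = _
    rw [col_smooth hrot, hedge, hd]
    simp
  · intro d hd
    change D.smooth _ (D.edge d) = Equiv.swap _ _ (D.smooth v (D.edge d))
    have hd2 : col (D.edge d) = !col (c, 0) := by rw [hedge, hd]
    generalize D.edge d = e at hd2
    obtain ⟨x, i⟩ := e
    by_cases hx : x = c
    · subst hx
      have : i = 1 ∨ i = 3 := by
        fin_cases i <;> simp_all
      rcases this with rfl | rfl
      · simp [smooth, mate, hc]
      · simp [smooth, mate, hc]
    · rw [Equiv.swap_apply_of_ne_of_ne]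
      · simp [smooth, hx]
      · simp [smooth, hx]
      · simp [smooth, hx]

theorem sum_circles {v w : D.Vertex} {c : Fin D.crossings} (hvw : ∀ x, x ≠ c → v x = w x)
    (src : D.Circles v → D.SaddlePieces v w) (hsrc : ∀ x, src (Quot.mk _ x) = Quot.mk _ x)
    (hends : ∀ i : Fin 4, (Quot.mk _ (Sum.inl (c, i)) : D.SaddlePieces v w) =
      Quot.mk _ (Sum.inl (c, 0)))
    (g : D.SaddlePieces v w → ℤ) [Decidable
      ((Quot.mk _ (Sum.inl (c, 0)) : D.Circles v) = Quot.mk _ (Sum.inl (c, 2)))] :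
    ∑ x, g (src x) = ∑ k, g k +
      if (Quot.mk _ (Sum.inl (c, 0)) : D.Circles v) = Quot.mk _ (Sum.inl (c, 2)) then 0
      else g (Quot.mk _ (Sum.inl (c, 0))) := by
  classical
  set p : D.Circles v := Quot.mk _ (Sum.inl (c, 0)) with hp
  set q : D.Circles v := Quot.mk _ (Sum.inl (c, 2)) with hq
  have h4 : ∀ i : Fin 4, (Quot.mk _ (Sum.inl (c, i)) : D.Circles v) = p ∨
      (Quot.mk _ (Sum.inl (c, i)) : D.Circles v) = q := by
    have hs : ∀ i, (Quot.mk _ (Sum.inl (c, i)) : D.Circles v) =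
        Quot.mk _ (Sum.inl (c, mate (v c) i)) := fun i => Quot.sound (Joined.smooth (c, i))
    intro i
    cases hv : v c <;> rw [hv] at hs <;> fin_cases i
    · exact Or.inl rfl
    · exact Or.inl (hs 1)
    · exact Or.inr rfl
    · exact Or.inr (hs 3)
    · exact Or.inl rfl
    · exact Or.inr (hs 1)
    · exact Or.inr rfl
    · exact Or.inl (hs 3)
  let r : D.SaddlePieces v w → D.Circles v :=
    Quot.lift (fun x => if (Quot.mk _ x : D.Circles v) = q then p else Quot.mk _ x) (by
      rintro x y (h | h)
      · rw [Quot.sound h]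
      · have hv : D.Joined v x y ∨ ∃ d, d.1 = c ∧ x = Sum.inl d ∧ y = Sum.inl (D.smooth w d) := by
          cases h with
          | edge d => exact Or.inl (Joined.edge d)
          | smooth d =>
            by_cases hd : d.1 = c
            · exact Or.inr ⟨d, hd, rfl, rfl⟩
            · left
              have : D.smooth w d = D.smooth v d := by simp [smooth, hvw _ hd]
              rw [this]
              exact Joined.smooth d
        rcases hv with h | ⟨⟨c', i⟩, hc, rfl, rfl⟩
        · rw [Quot.sound h]
        · obtain rfl : c' = c := hc
          have key : ∀ i, (if (Quot.mk _ (Sum.inl (c', i)) : D.Circles v) = q then p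
              else Quot.mk _ (Sum.inl (c', i))) = p := by
            intro i
            split_ifs with h
            · rfl
            · exact (h4 i).resolve_right h
          exact (key _).trans (key _).symm)
  have hr : ∀ x : D.Circles v, r (src x) = if x = q then p else x := by
    intro x
    induction x using Quot.ind with
    | _ x => rw [hsrc]
  have hsr : ∀ k, src (r k) = k := by
    intro k
    induction k using Quot.ind with
    | _ x =>
      change src (if _ then _ else _) = _
      split_ifs with h
      · rw [hp, hsrc]
        have : src (Quot.mk _ x) = src q := by rw [h]
        rw [hsrc, hq, hsrc] at this
        rw [this, hends 2]
      · rw [hsrc]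
  have hrinj : Function.Injective r := fun a b h => by rw [← hsr a, ← hsr b, h]
  have hsum : ∑ k, g k = ∑ x ∈ Finset.univ.image r, g (src x) := by
    rw [Finset.sum_image (fun a _ b _ h => hrinj h)]
    simp only [hsr]
  rw [hsum]
  split_ifs with hpq
  · have : Finset.univ.image r = Finset.univ := by
      ext x
      simp only [Finset.mem_image, Finset.mem_univ, true_and, iff_true]
      refine ⟨src x, ?_⟩
      rw [hr]
      split_ifs with h
      · rw [h]
        exact hpq
      · rfl
    rw [this, add_zero]
  · have : Finset.univ.image r = Finset.univ.erase q := by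
      ext x
      simp only [Finset.mem_image, Finset.mem_univ, true_and, Finset.mem_erase, and_true]
      constructor
      · rintro ⟨k, rfl⟩ h
        have h1 := hr q
        rw [if_pos rfl] at h1
        have h2 : r (src (r k)) = p := by rw [h, h1]
        rw [hsr, h] at h2
        exact hpq h2.symm
      · intro h
        exact ⟨src x, by rw [hr, if_neg h]⟩
    rw [this]
    have hgq : g (src q) = g (Quot.mk _ (Sum.inl (c, 0))) := by rw [hq, hsrc, hends 2]
    rw [← hgq, Finset.sum_erase_add _ _ (Finset.mem_univ q)]

/-- A saddle has three boundary circles. -/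
theorem sum_saddle (v w : D.Vertex) (c : Fin D.crossings) (hc : v c = false)
    (hw : w = Function.update v c true) (g : D.SaddlePieces v w → ℤ) :
    ∑ x, g ((D.saddle v w).src x) + ∑ x, g ((D.saddle v w).tgt x) =
    2 * ∑ k, g k + g (Quot.mk _ (Sum.inl (c, 0))) := by
  classical
  have hwc : w c = true := by simp [hw]
  have h01 : (Quot.mk _ (Sum.inl (c, 0)) : D.SaddlePieces v w) = Quot.mk _ (Sum.inl (c, 1)) := by
    have := Joined.smooth (D := D) (v := v) (c, 0)
    simp only [smooth, hc] at this
    exact Quot.sound (Or.inl this)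
  have h23 : (Quot.mk _ (Sum.inl (c, 2)) : D.SaddlePieces v w) = Quot.mk _ (Sum.inl (c, 3)) := by
    have := Joined.smooth (D := D) (v := v) (c, 2)
    simp only [smooth, hc] at this
    exact Quot.sound (Or.inl this)
  have h03 : (Quot.mk _ (Sum.inl (c, 0)) : D.SaddlePieces v w) = Quot.mk _ (Sum.inl (c, 3)) := by
    have := Joined.smooth (D := D) (v := w) (c, 0)
    simp only [smooth, hwc] at this
    exact Quot.sound (Or.inr this)
  have hends : ∀ i : Fin 4, (Quot.mk _ (Sum.inl (c, i)) : D.SaddlePieces v w) =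
      Quot.mk _ (Sum.inl (c, 0)) := by
    intro i
    fin_cases i
    · rfl
    · exact h01.symm
    · exact h23.trans h03.symm
    · exact h03.symm
  have hvw : ∀ x, x ≠ c → v x = w x := fun x hx => by simp [hw, hx]
  have h1 := sum_circles hvw (D.saddle v w).src (fun x => rfl) hends g
  let e : D.SaddlePieces w v ≃ D.SaddlePieces v w := Quot.congrRight (fun x y => or_comm)
  have h2 : ∑ x, g ((D.saddle v w).tgt x) = ∑ k, g k +
      if (Quot.mk _ (Sum.inl (c, 0)) : D.Circles w) = Quot.mk _ (Sum.inl (c, 2)) then 0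
      else g (Quot.mk _ (Sum.inl (c, 0))) := by
    refine Eq.trans (Finset.sum_congr rfl fun x _ => congrArg g (e.apply_symm_apply _).symm)
      ((sum_circles (v := w) (w := v) (c := c) (fun x hx => (hvw x hx).symm)
        (fun x => e.symm ((D.saddle v w).tgt x)) (fun x => rfl)
        (fun i => congrArg e.symm (hends i)) (fun k => g (e k))).trans ?_)
    rw [e.sum_comp g]
    rfl
  have h3 := circles_dichotomy v w c hc hw
  refine (congrArg₂ (· + ·) h1 h2).trans ?_
  by_cases h : (Quot.mk _ (Sum.inl (c, 0)) : D.Circles v) = Quot.mk _ (Sum.inl (c, 2))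
  · rw [if_pos h, if_neg (fun h' => h3.1 h' h)]; ring
  · rw [if_neg h, if_pos (h3.2 h)]; ring

theorem joined_sound {v u w : D.Vertex} (hu : ∀ x, u x = v x ∨ u x = w x) {x y : D.Piece}
    (h : D.Joined u x y) : (Quot.mk _ x : D.SaddlePieces v w) = Quot.mk _ y := by
  cases h with
  | edge d => exact Quot.sound (Or.inl (Joined.edge d))
  | smooth d =>
    rcases hu d.1 with h | h
    · have : D.smooth u d = D.smooth v d := by simp [smooth, h]
      rw [this]
      exact Quot.sound (Or.inl (Joined.smooth d))
    · have : D.smooth u d = D.smooth w d := by simp [smooth, h]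
      rw [this]
      exact Quot.sound (Or.inr (Joined.smooth d))

/-- The components of a composition of two saddles. -/
def glueSaddles (v u w : D.Vertex) (hu : ∀ x, u x = v x ∨ u x = w x) :
    (Surface.glue (D.saddle v u) (D.saddle u w)).K ≃ D.SaddlePieces v w where
  toFun := Quot.lift (Sum.elim
      (Quot.lift (fun x => Quot.mk _ x) (by
        rintro x y (h | h)
        · exact Quot.sound (Or.inl h)
        · exact joined_sound hu h))
      (Quot.lift (fun x => Quot.mk _ x) (by
        rintro x y (h | h)
        · exact joined_sound hu h
        · exact Quot.sound (Or.inr h))))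
    (by
      rintro _ _ ⟨b⟩
      induction b using Quot.ind
      rfl)
  invFun := Quot.lift (fun x => Quot.mk _ (Sum.inl (Quot.mk _ x))) (by
    rintro x y (h | h)
    · exact congrArg (fun z => Quot.mk _ (Sum.inl z)) (Quot.sound (Or.inl h))
    · have h1 : ∀ x, (Quot.mk (Surface.Glue (D.saddle v u) (D.saddle u w))
          (Sum.inl (Quot.mk _ x))) = Quot.mk _ (Sum.inr (Quot.mk _ x)) := fun x =>
        Quot.sound (Surface.Glue.mk (S := D.saddle v u) (T := D.saddle u w) (Quot.mk _ x))
      refine (h1 x).trans (Eq.trans ?_ (h1 y).symm)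
      exact congrArg (fun z => Quot.mk _ (Sum.inr z)) (Quot.sound (Or.inr h)))
  left_inv := by
    rintro ⟨x | x⟩
    · induction x using Quot.ind
      rfl
    · induction x using Quot.ind with
      | _ x =>
        exact Quot.sound (Surface.Glue.mk (S := D.saddle v u) (T := D.saddle u w) (Quot.mk _ x))
  right_inv := by
    rintro ⟨x⟩
    rfl

theorem glueSaddles_excess (v : D.Vertex) (c c' : Fin D.crossings) (hc : v c = false)
    (hc' : v c' = false) (hne : c ≠ c') (u w : D.Vertex) (huv : u = Function.update v c true)
    (hwu : w = Function.update u c' true) (hu : ∀ x, u x = v x ∨ u x = w x)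
    (g : D.SaddlePieces v w → ℤ) :
    2 * ∑ k, g (glueSaddles v u w hu k) *
        (Surface.glue (D.saddle v u) (D.saddle u w)).excess k =
      g (Quot.mk _ (Sum.inl (c, 0))) + g (Quot.mk _ (Sum.inl (c', 0))) -
        ∑ x, g ((D.saddle v w).src x) - ∑ x, g ((D.saddle v w).tgt x) := by
  have huc' : u c' = false := by simp [huv, hne.symm, hc']
  let e := glueSaddles v u w hu
  have h0 := Surface.glue_sum (D.saddle v u) (D.saddle u w) (fun k => g (e k))
  have h1 := sum_saddle v u c hc huv (fun k => g (e (Quot.mk _ (Sum.inl k))))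
  have h2 := sum_saddle u w c' huc' hwu (fun k => g (e (Quot.mk _ (Sum.inr k))))
  have h3 : ∑ k, g (e (Quot.mk _ (Sum.inl k))) * (D.saddle v u).excess k =
      - ∑ k : D.SaddlePieces v u, g (e (Quot.mk _ (Sum.inl k))) := by
    rw [← Finset.sum_neg_distrib]
    exact Finset.sum_congr rfl fun k _ => mul_neg_one _
  have h4 : ∑ k, g (e (Quot.mk _ (Sum.inr k))) * (D.saddle u w).excess k =
      - ∑ k : D.SaddlePieces u w, g (e (Quot.mk _ (Sum.inr k))) := by
    rw [← Finset.sum_neg_distrib]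
    exact Finset.sum_congr rfl fun k _ => mul_neg_one _
  have h5 : ∑ x, g (e (Quot.mk _ (Sum.inl ((D.saddle v u).src x)))) =
      ∑ x, g ((D.saddle v w).src x) := by
    refine Finset.sum_congr rfl fun x _ => ?_
    induction x using Quot.ind
    rfl
  have h6 : ∑ x, g (e (Quot.mk _ (Sum.inr ((D.saddle u w).tgt x)))) =
      ∑ x, g ((D.saddle v w).tgt x) := by
    refine Finset.sum_congr rfl fun x _ => ?_
    induction x using Quot.ind
    rfl
  have h7 : ∑ x, g (e (Quot.mk _ (Sum.inr ((D.saddle u w).src x)))) =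
      ∑ x, g (e (Quot.mk _ (Sum.inl ((D.saddle v u).tgt x)))) := by
    refine Finset.sum_congr rfl fun x _ => ?_
    induction x using Quot.ind
    rfl
  have h8 : g (e (Quot.mk _ (Sum.inl (Quot.mk _ (Sum.inl (c, 0)))))) =
      g (Quot.mk _ (Sum.inl (c, 0))) := rfl
  have h9 : g (e (Quot.mk _ (Sum.inr (Quot.mk _ (Sum.inl (c', 0)))))) =
      g (Quot.mk _ (Sum.inl (c', 0))) := rfl
  rw [h3, h4] at h0
  have h1' := (congrArg₂ (· + ·) h5.symm rfl).trans h1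
  have h2' := (congrArg₂ (· + ·) h7.symm h6.symm).trans h2
  rw [h8] at h1'
  rw [h9] at h2'
  refine (congrArg (2 * ·) h0).trans ?_
  linarith

theorem saddle_comm (v : D.Vertex) (c c' : Fin D.crossings) (hc : v c = false)
    (hc' : v c' = false) (hne : c ≠ c') (u u' w : D.Vertex) (huv : u = Function.update v c true)
    (hwu : w = Function.update u c' true) (huv' : u' = Function.update v c' true)
    (hwu' : w = Function.update u' c true) :
    Surface.Homeo (Surface.glue (D.saddle v u) (D.saddle u w))
      (Surface.glue (D.saddle v u') (D.saddle u' w)) := by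
  have hu : ∀ x, u x = v x ∨ u x = w x := by
    intro x
    by_cases hx : x = c'
    · left; subst hx; simp [huv, hne.symm]
    · right; simp [hwu, hx]
  have hu' : ∀ x, u' x = v x ∨ u' x = w x := by
    intro x
    by_cases hx : x = c
    · left; subst hx; simp [huv', hne]
    · right; simp [hwu', hx]
  let e := glueSaddles v u w hu
  let e' := glueSaddles v u' w hu'
  refine ⟨e.trans e'.symm, Surface.genus_ext _ ?_, ?_, ?_⟩
  · intro g
    have h1 := glueSaddles_excess v c c' hc hc' hne u w huv hwu hu (fun k => g (e'.symm k))
    have h2 := glueSaddles_excess v c' c hc' hc hne.symm u' w huv' hwu' hu'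
      (fun k => g (e'.symm k))
    have h3 : ∀ k, e'.symm (glueSaddles v u' w hu' k) = k := e'.symm_apply_apply
    simp only [h3] at h2
    have h4 : ∀ k, (e.trans e'.symm) k = e'.symm (glueSaddles v u w hu k) := fun k => rfl
    simp only [h4]
    linarith
  · intro x
    induction x using Quot.ind
    rfl
  · intro x
    rw [Equiv.trans_apply, Equiv.symm_apply_eq]
    induction x using Quot.ind
    rfl

end saddles

/-! #### The complex of a link diagram -/

section complex

variable (R : Type u) [CommRing R]

/-- The smoothing `v` as an object, with its degree shift. -/
abbrev vertexObj (v : D.Vertex) : Cob R := ⟨D.Circles v, D.height v + D.nPlus - 2 * D.nMinus⟩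

/-- The number of 1-smoothings before the crossing `c`. -/
def before (v : D.Vertex) (c : Fin D.crossings) : ℕ :=
  (Finset.univ.filter fun j => j < c ∧ v j = true).card

/-- The contribution of the crossing `c` to the map from the smoothing `v` to the smoothing `w`:
the signed saddle, if `w` is obtained from `v` by changing the smoothing at `c` from `0` to `1`. -/
def edgeMap (v w : D.Vertex) (c : Fin D.crossings) : D.vertexObj R v ⟶ D.vertexObj R w :=
  if v c = false ∧ w = Function.update v c true then
    ((-1 : R) ^ D.before v c) • Cob.ofSurface (D.saddle v w) else 0

/-- The chain object in homological degree `h`: the column of all smoothings `v` of height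
`h + nMinus`. -/
abbrev chainObj (h : ℤ) : Mat_ (Cob R) where
  ι := {v : D.Vertex // (D.height v : ℤ) = h + D.nMinus}
  X v := D.vertexObj R v.1

def differential (h : ℤ) : D.chainObj R h ⟶ D.chainObj R (h + 1) :=
  fun v w => ∑ c, D.edgeMap R v.1 w.1 c

variable {D}

theorem height_update (v : D.Vertex) (c : Fin D.crossings) (hc : v c = false) :
    D.height (Function.update v c true) = D.height v + 1 := by
  have : (Finset.univ.filter fun x => Function.update v c true x = true) =
      insert c (Finset.univ.filter fun x => v x = true) := by
    ext x
    by_cases hx : x = c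
    · subst hx; simp
    · simp [hx]
  rw [height, this, Finset.card_insert_of_notMem (by simp [hc]), height]

theorem before_update (v : D.Vertex) (c c' : Fin D.crossings) (hc : v c = false) :
    D.before (Function.update v c true) c' = D.before v c' + if c < c' then 1 else 0 := by
  unfold before
  split_ifs with h
  · have : (Finset.univ.filter fun x => x < c' ∧ Function.update v c true x = true) =
        insert c (Finset.univ.filter fun x => x < c' ∧ v x = true) := by
      ext x
      by_cases hx : x = c
      · subst hx; simp [h]
      · simp [hx]
    rw [this, Finset.card_insert_of_notMem (by simp [hc])]
  · rw [add_zero]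
    congr 1
    ext x
    by_cases hx : x = c
    · subst hx; simp [h]
    · simp [hx]

theorem edgeMap_comp_swap (v w : D.Vertex) (c c' : Fin D.crossings) :
    D.edgeMap R v (Function.update v c true) c ≫ D.edgeMap R (Function.update v c true) w c' +
      D.edgeMap R v (Function.update v c' true) c' ≫
        D.edgeMap R (Function.update v c' true) w c = 0 := by
  by_cases hne : c = c'
  · subst hne
    simp [edgeMap]
  by_cases hw : w = Function.update (Function.update v c true) c' true
  · have hw' : w = Function.update (Function.update v c' true) c true := by
      rw [hw, Function.update_comm hne]
    by_cases hc : v c = false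
    · by_cases hc' : v c' = false
      · have h1 : Function.update v c true c' = false := by
          rw [Function.update_of_ne (Ne.symm hne), hc']
        have h2 : Function.update v c' true c = false := by
          rw [Function.update_of_ne hne, hc]
        unfold edgeMap
        rw [if_pos ⟨hc, rfl⟩, if_pos ⟨h1, hw⟩, if_pos ⟨hc', rfl⟩, if_pos ⟨h2, hw'⟩,
          Linear.smul_comp, Linear.comp_smul, Linear.smul_comp, Linear.comp_smul,
          Cob.ofSurface_comp, Cob.ofSurface_comp,
          Cob.ofSurface_eq (saddle_comm v c c' hc hc' hne _ _ w rfl hw rfl hw'),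
          smul_smul, smul_smul, ← add_smul, before_update v c c' hc, before_update v c' c hc']
        rcases lt_or_gt_of_ne hne with h | h
        · rw [if_pos h, if_neg h.asymm]
          convert zero_smul R _ using 2
          ring
        · rw [if_neg h.asymm, if_pos h]
          convert zero_smul R _ using 2
          ring
      · have h1 : ¬ Function.update v c true c' = false := by
          rw [Function.update_of_ne (Ne.symm hne)]; exact hc'
        simp [edgeMap, hc', h1]
    · have h2 : ¬ Function.update v c' true c = false := by
        rw [Function.update_of_ne hne]; exact hc
      simp [edgeMap, hc, h2]
  · have hw' : ¬ w = Function.update (Function.update v c' true) c true := by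
      rwa [Function.update_comm (Ne.symm hne)]
    simp [edgeMap, hw, hw']

theorem differential_sq (h : ℤ) : D.differential R h ≫ D.differential R (h + 1) = 0 := by
  ext v w
  obtain ⟨v, hv⟩ := v
  rw [Mat_.comp_apply]
  change ∑ u : {u : D.Vertex // (D.height u : ℤ) = h + 1 + D.nMinus},
    (∑ c, D.edgeMap R v u.1 c) ≫ (∑ c, D.edgeMap R u.1 w.1 c) = 0
  have hzero : ∀ u : D.Vertex, ∀ c, u ≠ Function.update v c true → D.edgeMap R v u c = 0 := by
    intro u c hu
    exact if_neg fun hh => hu hh.2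
  have h1 : ∑ u : {u : D.Vertex // (D.height u : ℤ) = h + 1 + D.nMinus},
      (∑ c, D.edgeMap R v u.1 c) ≫ (∑ c, D.edgeMap R u.1 w.1 c) =
      ∑ u : D.Vertex, (∑ c, D.edgeMap R v u c) ≫ (∑ c, D.edgeMap R u w.1 c) := by
    rw [← Finset.sum_subtype
      (Finset.univ.filter fun u : D.Vertex => (D.height u : ℤ) = h + 1 + D.nMinus) (by simp)
      (fun u : D.Vertex => (∑ c, D.edgeMap R v u c) ≫ (∑ c, D.edgeMap R u w.1 c))]
    refine Finset.sum_subset (Finset.subset_univ _) fun u _ hu => ?_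
    rw [Finset.mem_filter, not_and] at hu
    have : ∑ c, D.edgeMap R v u c = 0 := by
      refine Finset.sum_eq_zero fun c _ => if_neg ?_
      rintro ⟨hc, rfl⟩
      refine hu (Finset.mem_univ _) ?_
      rw [height_update v c hc]
      push_cast
      linarith
    rw [this, Limits.zero_comp]
  rw [h1]
  have h2 : ∀ u : D.Vertex, (∑ c, D.edgeMap R v u c) ≫ (∑ c, D.edgeMap R u w.1 c) =
      ∑ p : Fin D.crossings × Fin D.crossings,
        D.edgeMap R v u p.1 ≫ D.edgeMap R u w.1 p.2 := by
    intro u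
    rw [Preadditive.sum_comp, Fintype.sum_prod_type]
    exact Finset.sum_congr rfl fun c _ => Preadditive.comp_sum _ _ _
  rw [Finset.sum_congr rfl fun u _ => h2 u, Finset.sum_comm]
  have h3 : ∀ p : Fin D.crossings × Fin D.crossings,
      ∑ u, D.edgeMap R v u p.1 ≫ D.edgeMap R u w.1 p.2 =
        D.edgeMap R v (Function.update v p.1 true) p.1 ≫
          D.edgeMap R (Function.update v p.1 true) w.1 p.2 := by
    intro p
    refine Finset.sum_eq_single _ (fun u _ hu => ?_) (fun h => absurd (Finset.mem_univ _) h)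
    rw [hzero u _ hu, Limits.zero_comp]
  rw [Finset.sum_congr rfl fun p _ => h3 p]
  refine Finset.sum_involution (fun p _ => p.swap) (fun p _ => edgeMap_comp_swap R v w.1 p.1 p.2)
    ?_ (fun _ _ => Finset.mem_univ _) (fun p _ => Prod.swap_swap p)
  rintro ⟨c, c'⟩ - hne heq
  obtain rfl : c' = c := congrArg Prod.fst heq
  exact hne (by simp [edgeMap])

variable (D)

/-- The complex of the link diagram in `Kom(Mat(Cob))`. -/
def complex : CochainComplex (Mat_ (Cob R)) ℤ :=
  CochainComplex.of (D.chainObj R) (D.differential R) (differential_sq R)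

end complex

end LinkDiagram

/-! ### Free `R[T]`-modules and their realization by columns of empty sets -/

/-- A graded free `R[T]`-module of finite rank, given by the degrees of the members of a basis. -/
structure FreeMod (R : Type u) where
  ι : Type
  [fintypeIdx : Fintype ι]
  deg : ι → ℤ

namespace FreeMod

attribute [instance] FreeMod.fintypeIdx

variable {R : Type u} [CommRing R]

/-- The underlying `R[T]`-module. -/
abbrev Carrier (F : FreeMod R) : Type u := F.ι → R[X]

/-- Morphisms are the `R[T]`-linear maps, of all degrees. -/
instance : Category (FreeMod R) where
  Hom F G := F.Carrier →ₗ[R[X]] G.Carrier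
  id F := LinearMap.id
  comp f g := g ∘ₗ f

instance : Preadditive (FreeMod R) where
  homGroup F G := inferInstanceAs (AddCommGroup (F.Carrier →ₗ[R[X]] G.Carrier))
  add_comp _ _ _ f f' g := LinearMap.comp_add f f' g
  comp_add _ _ _ f g g' := LinearMap.add_comp f g' g

open Classical in
/-- The matrix entries of a linear map. -/
def entry {F G : FreeMod R} (f : F ⟶ G) (i : F.ι) (j : G.ι) : R[X] :=
  (show F.Carrier →ₗ[R[X]] G.Carrier from f) (Pi.single i 1) j

/-- The linear map preserves degrees, where `T` has degree `-4`. -/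
def DegreeZero {F G : FreeMod R} (f : F ⟶ G) : Prop :=
  ∀ i j k, (entry f i j).coeff k ≠ 0 → G.deg j - F.deg i - 4 * (k : ℤ) = 0

open Classical in
theorem entry_id (F : FreeMod R) (i j : F.ι) : entry (𝟙 F) i j = if i = j then 1 else 0 := by
  change (Pi.single i 1 : F.ι → R[X]) j = _
  rw [Pi.single_apply]
  exact if_congr eq_comm rfl rfl

theorem entry_comp {F G H : FreeMod R} (f : F ⟶ G) (g : G ⟶ H) (i : F.ι) (k : H.ι) :
    entry (f ≫ g) i k = ∑ j, entry f i j * entry g j k := by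
  classical
  let f' : F.Carrier →ₗ[R[X]] G.Carrier := f
  let g' : G.Carrier →ₗ[R[X]] H.Carrier := g
  change g' (f' (Pi.single i 1)) k = ∑ j, f' (Pi.single i 1) j * g' (Pi.single j 1) k
  rw [LinearMap.pi_apply_eq_sum_univ g' (f' (Pi.single i 1)), Finset.sum_apply]
  refine Finset.sum_congr rfl fun j _ => ?_
  rw [Pi.smul_apply, smul_eq_mul]
  have h : (fun i => if j = i then (1 : R[X]) else 0) = Pi.single j 1 := by
    funext x
    rw [Pi.single_apply]
    exact if_congr eq_comm rfl rfl
  rw [← h]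

theorem entry_add {F G : FreeMod R} (f g : F ⟶ G) (i : F.ι) (j : G.ι) :
    entry (f + g) i j = entry f i j + entry g i j := rfl

end FreeMod

section realization

variable (R : Type u) [CommRing R] [Invertible (2 : R)]

/-- The disjoint union of `k` closed surfaces of genus three. -/
def genusThree (k : ℕ) : Surface Empty Empty where
  K := Fin k
  genus _ := 3
  src := Empty.elim
  tgt := Empty.elim

/-- Let polynomials in `T` act on the empty surface, where `T` is one half of the closed surface of
genus three: `T ^ k` becomes `2⁻¹ ^ k` times the union of `k` surfaces of genus three. -/
def closedSurfaces (m n : ℤ) : R[X] →ₗ[R] (Cob.empty R m ⟶ Cob.empty R n) :=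
  Polynomial.lsum fun k =>
    (⅟(2 : R) ^ k) • LinearMap.toSpanSingleton R _ (Cob.ofSurface (genusThree k))

variable {R}

theorem closedSurfaces_monomial (m n : ℤ) (k : ℕ) (a : R) :
    closedSurfaces R m n (monomial k a) =
      (⅟(2 : R) ^ k * a) • Cob.ofSurface (genusThree k) := by
  rw [closedSurfaces, Polynomial.lsum_apply, Polynomial.sum_monomial_index]
  · rw [LinearMap.smul_apply, LinearMap.toSpanSingleton_apply, smul_smul]
  · simp

theorem genusThree_glue (k l : ℕ) :
    ((genusThree k).glue (genusThree l)).Homeo (genusThree (k + l)) := by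
  let e : ((genusThree k).glue (genusThree l)).K ≃ Fin (k + l) :=
    { toFun := Quot.lift finSumFinEquiv (by rintro _ _ ⟨b⟩; exact b.elim)
      invFun := fun x => Quot.mk _ (finSumFinEquiv.symm x)
      left_inv := by
        intro x
        induction x using Quot.ind with
        | _ x => exact congrArg (Quot.mk _) (finSumFinEquiv.symm_apply_apply x)
      right_inv := fun x => finSumFinEquiv.apply_symm_apply x }
  refine ⟨e, Surface.genus_ext (T := genusThree (k + l)) e ?_, fun a => a.elim, fun a => a.elim⟩
  intro w
  refine (Surface.glue_sum _ _ (fun q => w (e q))).trans ?_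
  rw [Finset.univ_eq_empty (α := Empty), Finset.sum_empty, add_zero]
  refine Eq.trans ?_ (finSumFinEquiv.sum_comp
    (fun x => w x * (genusThree (k + l)).excess x))
  rw [Fintype.sum_sum_type]
  rfl

theorem closedSurfaces_one (m : ℤ) : closedSurfaces R m m 1 = 𝟙 _ := by
  rw [← monomial_zero_one, closedSurfaces_monomial, pow_zero, one_mul, one_smul]
  refine Cob.ofSurface_eq (X := Cob.empty R m) (Y := Cob.empty R m)
    (T := Surface.cylinder Empty) ?_
  exact ⟨Equiv.equivOfIsEmpty (Fin 0) Empty, fun k => k.elim0, fun a => a.elim, fun a => a.elim⟩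

theorem closedSurfaces_mul (l m n : ℤ) (p q : R[X]) :
    closedSurfaces R l m p ≫ closedSurfaces R m n q = closedSurfaces R l n (p * q) := by
  induction p using Polynomial.induction_on' with
  | add p p' hp hp' => rw [map_add, Preadditive.add_comp, hp, hp', add_mul, map_add]
  | monomial k a =>
    induction q using Polynomial.induction_on' with
    | add p p' hp hp' => rw [map_add, Preadditive.comp_add, hp, hp', mul_add, map_add]
    | monomial k' a' =>
      rw [monomial_mul_monomial, closedSurfaces_monomial, closedSurfaces_monomial,
        closedSurfaces_monomial, Linear.smul_comp, Linear.comp_smul, smul_smul]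
      have h1 : (Cob.ofSurface (genusThree k) : Cob.empty R l ⟶ Cob.empty R m) ≫
          (Cob.ofSurface (genusThree k') : Cob.empty R m ⟶ Cob.empty R n) =
          Cob.ofSurface (genusThree (k + k')) :=
        (Cob.ofSurface_comp (X := Cob.empty R l) (Y := Cob.empty R m) (Z := Cob.empty R n)
          (genusThree k) (genusThree k')).trans (Cob.ofSurface_eq (genusThree_glue k k'))
      rw [h1]
      congr 1
      ring

variable (R)

/-- The functor that sends a free module to the column of the empty sets, shifted by the degrees of
its basis, and a matrix over `R[T]` to the corresponding matrix of closed surfaces. -/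
def realize : FreeMod R ⥤ Mat_ (Cob R) where
  obj F := ⟨F.ι, fun i => Cob.empty R (F.deg i)⟩
  map {F G} f := fun i j => closedSurfaces R (F.deg i) (G.deg j) (FreeMod.entry f i j)
  map_id F := by
    ext i j
    by_cases h : i = j
    · subst h
      rw [FreeMod.entry_id, if_pos rfl, closedSurfaces_one, Mat_.id_apply_self]
    · rw [FreeMod.entry_id, if_neg h, map_zero, Mat_.id_apply_of_ne _ _ _ h]
  map_comp {F G H} f g := by
    ext i k
    rw [FreeMod.entry_comp, map_sum]
    exact Finset.sum_congr rfl fun j _ => (closedSurfaces_mul _ _ _ _ _).symm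

instance : (realize R).Additive where
  map_add {F G f g} := by
    ext i j
    exact map_add (closedSurfaces R (F.deg i) (G.deg j)) (FreeMod.entry f i j)
      (FreeMod.entry g i j)

end realization

open Classical in
/-- The graded free module that belongs to the chain object in homological degree `h`: every circle
of a smoothing is replaced by two generators, with degree shifts `+1` (for `true`) and `-1`. -/
def LinkDiagram.deloop (D : LinkDiagram) (R : Type u) (h : ℤ) : FreeMod R where
  ι := Σ v : {v : D.Vertex // (D.height v : ℤ) = h + D.nMinus}, (D.Circles v.1 → Bool)
  deg x := D.height x.1.1 + D.nPlus - 2 * D.nMinus + ∑ a, if x.2 a = true then 1 else -1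

end

/-!
The category of graded free `R[T]`-modules is compared with the columns of cobordisms in two steps:
the endomorphisms of the empty set are computed, and circles are delooped.

*Endomorphisms of the empty set.* A closed connected surface of genus `g` is given the value `0` if
`g` is even and `2 * T ^ k` if `g = 2 * k + 1`, and a closed surface the product of the values of
its components (`closedValue`). Twice the value of a surface with a tube between two components is
the sum of the values with a handle on the one and on the other (`two_mul_closedValue_tube`). The
right hand side is a sum of two terms, each of which depends on one end of the tube only, so the
value respects the four tube relation, and it descends to a map `value` from the endomorphisms of
`∅` to `R[T]`. It takes one half of the surface of genus three to `T`, so it is a left inverse of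
`closedSurfaces`, and `realize` is faithful.

Conversely, the four tube relation with two of the discs on an extra torus gives neck cutting: twice
a tube is a handle at one end plus a handle at the other, up to an extra component of genus two
(`Cob.ofSurface_tube_add_genusTwo`), which vanishes because `2` is invertible
(`Cob.ofSurface_addClosed_two`). Cutting a component of genus `g + 2` into genera `g` and `2` then
shows that two handles amount to a factor `T`, so that every closed surface is determined by its
value (`ofSurface_eq_closedSurfaces`), and `realize` is full.

*Delooping.* Cutting the necks of all cylinders over a collection of circles writes twice the
identity of each circle as the sum of two pairs of caps, one of which carries a handle
(`two_pow_smul_cylinder`). The composites of caps in the other order are closed surfaces, whose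
values are those of an identity matrix (`deloopIn_comp_deloopOut`). So a collection of circles is
isomorphic to the column of empty sets indexed by the signs of the circles (`deloopIso`). Transport
of the differential along these isomorphisms, which lifts to `R[T]`-modules since `realize` is full
and faithful, yields the required complex. All maps have degree `0`, as saddles have Euler
characteristic `-1` and as the Euler characteristic of a closed surface is the degree of its value.
-/

/-! ### Tubes, handles and closed components of surfaces -/

namespace Surface

variable {A B C : Type}

/-- Attaching a tube raises the total excess by one, at the component of the tube. -/
theorem tube_sum (S : Surface A B) (p q : S.K) (w : (S.tube p q).K → ℤ) :
    ∑ c, w c * (S.tube p q).excess c =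
      ∑ k, w (Quot.mk _ k) * S.excess k + w (Quot.mk _ p) := by
  classical
  let r : S.K → S.K → Prop := fun x y => x = p ∧ y = q
  let π : S.K → (S.tube p q).K := Quot.mk r
  have hpq : π p = π q := Quot.sound ⟨rfl, rfl⟩
  -- A fibre of the quotient map has one element, except for the fibre over distinct `p`, `q`.
  have hfib : ∀ x y : S.K, π x = π y → x = y ∨ ((x = p ∨ x = q) ∧ (y = p ∨ y = q)) := by
    intro x y h
    replace h := Quot.eqvGen_exact h
    induction h with
    | rel x y h => exact Or.inr ⟨Or.inl h.1, Or.inr h.2⟩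
    | refl x => exact Or.inl rfl
    | symm x y _ ih => rcases ih with h | h; exacts [Or.inl h.symm, Or.inr h.symm]
    | trans x y z _ _ h1 h2 =>
      rcases h1 with rfl | h1
      · exact h2
      · rcases h2 with rfl | h2
        · exact Or.inr h1
        · exact Or.inr ⟨h1.1, h2.2⟩
  have hex : ∀ c : (S.tube p q).K, (S.tube p q).excess c =
      (∑ k with π k = c, S.excess k) + if π p = c then 1 else 0 := by
    intro c
    have hcard : ((∑ k with π k = c, (1 : ℤ)) : ℤ) =
        1 + if p ≠ q ∧ π p = c then 1 else 0 := by
      rw [Finset.sum_const, nsmul_one]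
      split_ifs with h
      · obtain ⟨hne, rfl⟩ := h
        have : (Finset.univ.filter fun k => π k = π p) = {p, q} := by
          ext k
          simp only [Finset.mem_filter, Finset.mem_univ, true_and, Finset.mem_insert,
            Finset.mem_singleton]
          constructor
          · intro hk
            rcases hfib _ _ hk with h | h
            exacts [Or.inl h, h.1]
          · rintro (rfl | rfl)
            exacts [rfl, hpq.symm]
        rw [this, Finset.card_pair hne]
        norm_num
      · obtain ⟨k, rfl⟩ := Quot.exists_rep c
        have : (Finset.univ.filter fun x => π x = π k) = {k} := by
          ext x
          simp only [Finset.mem_filter, Finset.mem_univ, true_and, Finset.mem_singleton]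
          constructor
          · intro hx
            rcases hfib _ _ hx with hh | ⟨h1, h2⟩
            · exact hh
            · by_cases hne : p = q
              · subst hne
                rcases h1 with rfl | rfl <;> rcases h2 with rfl | rfl <;> rfl
              · refine absurd ⟨hne, ?_⟩ h
                change π p = π k
                rcases h2 with rfl | rfl
                exacts [rfl, hpq]
          · rintro rfl; rfl
        change ((Finset.univ.filter fun x => π x = π k).card : ℤ) = _
        rw [this]
        simp
    have : (S.tube p q).excess c =
        (((∑ k with π k = c, S.genus k) + if p = q ∧ π p = c then 1 else 0 : ℕ) : ℤ) - 1 := rfl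
    rw [this]
    simp only [excess, Finset.sum_sub_distrib]
    rw [hcard]
    push_cast
    by_cases h1 : p = q <;> by_cases h2 : π p = c <;> simp [h1, h2] <;> ring
  simp only [hex, mul_add, Finset.sum_add_distrib]
  congr 1
  · refine Eq.trans (Finset.sum_congr rfl fun c _ => ?_)
      (Finset.sum_fiberwise Finset.univ π fun k => w (π k) * S.excess k)
    rw [Finset.mul_sum]
    refine Finset.sum_congr rfl fun x hx => ?_
    rw [(Finset.mem_filter.1 hx).2]
  · refine (Finset.sum_congr rfl fun c _ => mul_ite_zero _ _ _).trans ?_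
    rw [Finset.sum_ite_eq Finset.univ (π p), if_pos (Finset.mem_univ _), mul_one]

/-- Recognizing a surface as the result of attaching a tube: `f` identifies the components `p` and
`q` and nothing else, and the genera are compared by integrating test functions. -/
theorem tube_homeo {S : Surface A B} {p q : S.K} {T : Surface A B} (f : S.K → T.K)
    (hf : f p = f q) (g : T.K → S.K) (hfg : ∀ k, f (g k) = k)
    (hgf : ∀ k, g (f k) = k ∨ (g (f k) = p ∧ k = q))
    (hw : ∀ w : T.K → ℤ, ∑ k, w (f k) * S.excess k + w (f p) = ∑ k, w k * T.excess k)
    (hsrc : ∀ a, f (S.src a) = T.src a) (htgt : ∀ b, f (S.tgt b) = T.tgt b) :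
    Homeo (S.tube p q) T := by
  let e : (S.tube p q).K ≃ T.K :=
    { toFun := Quot.lift f (by rintro _ _ ⟨rfl, rfl⟩; exact hf)
      invFun := fun k => Quot.mk _ (g k)
      left_inv := by
        rintro ⟨k⟩
        rcases hgf k with h | h
        · exact congrArg (Quot.mk _) h
        · exact Quot.sound h
      right_inv := hfg }
  refine ⟨e, genus_ext e fun w => ?_, hsrc, htgt⟩
  exact (tube_sum S p q fun c => w (e c)).trans (hw w)

open Classical in
/-- Add a handle to the component `p`. -/
noncomputable def handle (S : Surface A B) (p : S.K) : Surface A B where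
  K := S.K
  genus k := S.genus k + if k = p then 1 else 0
  src := S.src
  tgt := S.tgt

theorem tube_self (S : Surface A B) (p : S.K) : Homeo (S.tube p p) (S.handle p) := by
  classical
  refine tube_homeo (T := S.handle p) (fun k => k) rfl (fun k => k) (fun _ => rfl)
    (fun _ => Or.inl rfl) (fun w => ?_) (fun _ => rfl) (fun _ => rfl)
  have : ∀ k, (S.handle p).excess k = S.excess k + if k = p then 1 else 0 := by
    intro k
    have h : (S.handle p).excess k = ((S.genus k + if k = p then 1 else 0 : ℕ) : ℤ) - 1 := rfl
    rw [h]
    change _ = (S.genus k : ℤ) - 1 + _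
    split_ifs <;> push_cast <;> ring
  simp only [this, mul_add]
  refine Eq.trans ?_ Finset.sum_add_distrib.symm
  congr 1
  refine Eq.symm ((Finset.sum_congr rfl fun c _ => mul_ite_zero _ _ _).trans ?_)
  exact (Finset.sum_ite_eq' (Finset.univ : Finset S.K) p _).trans
    ((if_pos (Finset.mem_univ _)).trans (mul_one _))

/-- Recognizing a surface as the result of adding a handle. -/
theorem handle_homeo {S T : Surface A B} {p : S.K} (e : S.K ≃ T.K)
    (hp : T.genus (e p) = S.genus p + 1) (hne : ∀ k, k ≠ p → T.genus (e k) = S.genus k)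
    (hsrc : ∀ a, e (S.src a) = T.src a) (htgt : ∀ b, e (S.tgt b) = T.tgt b) :
    Homeo (S.handle p) T := by
  classical
  refine ⟨e, fun (k : S.K) => ?_, hsrc, htgt⟩
  by_cases hk : k = p
  · subst hk
    exact hp.trans (congrArg (S.genus k + ·) (if_pos rfl).symm)
  · exact (hne k hk).trans ((add_zero (S.genus k)).symm.trans
      (congrArg (S.genus k + ·) (if_neg hk).symm))

theorem handle_addClosed_none (S : Surface A B) (n : ℕ) :
    Homeo ((S.addClosed n).handle none) (S.addClosed (n + 1)) := by
  refine handle_homeo (S := S.addClosed n) (Equiv.refl _) rfl ?_ (fun _ => rfl) (fun _ => rfl)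
  rintro (_ | k) h
  · exact absurd rfl h
  · rfl

theorem handle_addClosed_some (S : Surface A B) (n : ℕ) (p : S.K) :
    Homeo ((S.addClosed n).handle (some p)) ((S.handle p).addClosed n) := by
  classical
  refine handle_homeo (S := S.addClosed n) (Equiv.refl _) ?_ ?_ (fun _ => rfl) (fun _ => rfl)
  · exact congrArg (S.genus p + ·) (if_pos rfl)
  · rintro (_ | k) h
    · rfl
    · exact congrArg (S.genus k + ·) (if_neg fun hk => h (congrArg some hk))

theorem addClosed_comm (S : Surface A B) (m n : ℕ) :
    Homeo ((S.addClosed m).addClosed n) ((S.addClosed n).addClosed m) := by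
  let f : Option (Option S.K) → Option (Option S.K)
    | none => some none
    | some none => none
    | some (some k) => some (some k)
  have hf : ∀ k, f (f k) = k := by rintro (_ | _ | k) <;> rfl
  refine ⟨⟨f, f, hf, hf⟩, ?_, fun _ => rfl, fun _ => rfl⟩
  rintro (_ | _ | k) <;> rfl

theorem sum_addClosed (S : Surface A B) (n : ℕ) (w : (S.addClosed n).K → ℤ) :
    ∑ k, w k * (S.addClosed n).excess k =
      w none * ((n : ℤ) - 1) + ∑ k, w (some k) * S.excess k :=
  Fintype.sum_option (fun k : Option S.K => w k * (S.addClosed n).excess k)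

theorem tube_addClosed_some (S : Surface A B) (n : ℕ) (p q : S.K) :
    Homeo ((S.addClosed n).tube (some p) (some q)) ((S.tube p q).addClosed n) := by
  let f : Option S.K → Option (S.tube p q).K := Option.map (Quot.mk _)
  let e : ((S.addClosed n).tube (some p) (some q)).K ≃ ((S.tube p q).addClosed n).K :=
    { toFun := Quot.lift f (by
        rintro _ _ ⟨rfl, rfl⟩
        exact congrArg some (Quot.sound ⟨rfl, rfl⟩))
      invFun := fun k => Option.elim k (Quot.mk _ none)
        (Quot.lift (fun k => Quot.mk _ (some k)) (by
          rintro _ _ ⟨rfl, rfl⟩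
          exact Quot.sound ⟨rfl, rfl⟩))
      left_inv := by rintro ⟨_ | k⟩ <;> rfl
      right_inv := by
        rintro (_ | k)
        · rfl
        · obtain ⟨k, rfl⟩ := Quot.exists_rep k
          rfl }
  refine ⟨e, genus_ext e fun w => ?_, fun _ => rfl, fun _ => rfl⟩
  refine (tube_sum _ _ _ fun c => w (e c)).trans ?_
  rw [sum_addClosed, sum_addClosed]
  refine Eq.trans ?_ (congrArg₂ (· + ·) rfl (tube_sum S p q fun c => w (some c)).symm)
  rw [add_assoc]
  rfl

open Classical in
/-- Attaching by a tube a closed component of genus `n` to the component `p` adds `n` to the genus of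
`p`. -/
theorem tube_addClosed_none {S T : Surface A B} {n : ℕ} {p : S.K} (e : S.K ≃ T.K)
    (hg : ∀ k, T.genus (e k) = S.genus k + if k = p then n else 0)
    (hsrc : ∀ a, e (S.src a) = T.src a) (htgt : ∀ b, e (S.tgt b) = T.tgt b) :
    Homeo ((S.addClosed n).tube (some p) none) T := by
  let f : Option S.K → T.K := fun k => e (k.getD p)
  refine tube_homeo (S := S.addClosed n) f rfl (fun k => some (e.symm k))
    (fun k => e.apply_symm_apply k) ?_ (fun w => ?_) hsrc htgt
  · rintro (_ | k)
    · exact Or.inr ⟨congrArg some (e.symm_apply_apply p), rfl⟩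
    · exact Or.inl (congrArg some (e.symm_apply_apply k))
  · rw [sum_addClosed, ← e.sum_comp]
    have : ∀ k, w (e k) * T.excess (e k) =
        w (e k) * S.excess k + if k = p then w (e k) * n else 0 := by
      intro k
      simp only [excess, hg]
      split_ifs <;> push_cast <;> ring
    simp only [this, Finset.sum_add_distrib, Finset.sum_ite_eq', Finset.mem_univ, if_true]
    simp only [f, Option.getD_some, Option.getD_none]
    ring

theorem tube_addClosed_one (S : Surface A B) (p : S.K) :
    Homeo ((S.addClosed 1).tube (some p) none) (S.handle p) := by
  classical
  exact tube_addClosed_none (Equiv.refl _) (fun _ => rfl) (fun _ => rfl)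
    (fun _ => rfl)

theorem tube_addClosed_addClosed (S : Surface A B) (m n : ℕ) :
    Homeo (((S.addClosed m).addClosed n).tube (some none) none) (S.addClosed (m + n)) := by
  classical
  refine tube_addClosed_none (Equiv.refl _) ?_ (fun _ => rfl) (fun _ => rfl)
  rintro (_ | k)
  · exact (congrArg (m + ·) (if_pos rfl)).symm
  · exact (add_zero (S.genus k)).symm.trans
      (congrArg (S.genus k + ·) (if_neg (Option.some_ne_none k)).symm)

section gluing

variable [Fintype B]

theorem glue_addClosed (S : Surface A B) (T : Surface B C) (n : ℕ) :
    Homeo (S.glue (T.addClosed n)) ((S.glue T).addClosed n) := by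
  let e : (S.glue (T.addClosed n)).K ≃ ((S.glue T).addClosed n).K :=
    { toFun := Quot.lift (Sum.elim (fun k => some (Quot.mk _ (Sum.inl k)))
        (Option.map fun k => Quot.mk _ (Sum.inr k))) (by
        rintro _ _ ⟨b⟩
        exact congrArg some (Quot.sound (Glue.mk b)))
      invFun := fun k => Option.elim k (Quot.mk _ (Sum.inr none))
        (Quot.lift (Sum.elim (fun k => Quot.mk _ (Sum.inl k))
          (fun k => Quot.mk _ (Sum.inr (some k)))) (by
          rintro _ _ ⟨b⟩
          exact Quot.sound (Glue.mk (S := S) (T := T.addClosed n) b)))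
      left_inv := by rintro ⟨k | _ | k⟩ <;> rfl
      right_inv := by
        rintro (_ | k)
        · rfl
        · obtain ⟨k | k, rfl⟩ := Quot.exists_rep k <;> rfl }
  refine ⟨e, genus_ext e fun w => ?_, fun _ => rfl, fun _ => rfl⟩
  refine (glue_sum _ _ fun c => w (e c)).trans ?_
  rw [sum_addClosed, sum_addClosed]
  refine Eq.trans ?_ (congrArg₂ (· + ·) rfl (glue_sum S T fun c => w (some c)).symm)
  have aux : ∀ a b c d : ℤ, a + (b + c) + d = b + (a + c + d) := by intros; ring
  exact aux _ _ _ _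

theorem addClosed_glue (S : Surface A B) (T : Surface B C) (n : ℕ) :
    Homeo ((S.addClosed n).glue T) ((S.glue T).addClosed n) := by
  let e : ((S.addClosed n).glue T).K ≃ ((S.glue T).addClosed n).K :=
    { toFun := Quot.lift (Sum.elim (Option.map fun k => Quot.mk _ (Sum.inl k))
        (fun k => some (Quot.mk _ (Sum.inr k)))) (by
        rintro _ _ ⟨b⟩
        exact congrArg some (Quot.sound (Glue.mk b)))
      invFun := fun k => Option.elim k (Quot.mk _ (Sum.inl none))
        (Quot.lift (Sum.elim (fun k => Quot.mk _ (Sum.inl (some k)))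
          (fun k => Quot.mk _ (Sum.inr k))) (by
          rintro _ _ ⟨b⟩
          exact Quot.sound (Glue.mk (S := S.addClosed n) (T := T) b)))
      left_inv := by rintro ⟨(_ | k) | k⟩ <;> rfl
      right_inv := by
        rintro (_ | k)
        · rfl
        · obtain ⟨k | k, rfl⟩ := Quot.exists_rep k <;> rfl }
  refine ⟨e, genus_ext e fun w => ?_, fun _ => rfl, fun _ => rfl⟩
  refine (glue_sum _ _ fun c => w (e c)).trans ?_
  rw [sum_addClosed, sum_addClosed]
  refine Eq.trans ?_ (congrArg₂ (· + ·) rfl (glue_sum S T fun c => w (some c)).symm)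
  have aux : ∀ a b c d : ℤ, a + b + c + d = a + (b + c + d) := by intros; ring
  exact aux _ _ _ _

theorem glue_tube (S : Surface A B) (T : Surface B C) (p q : T.K) :
    Homeo (S.glue (T.tube p q))
      ((S.glue T).tube (Quot.mk _ (Sum.inr p)) (Quot.mk _ (Sum.inr q))) := by
  let e : (S.glue (T.tube p q)).K ≃
      ((S.glue T).tube (Quot.mk _ (Sum.inr p)) (Quot.mk _ (Sum.inr q))).K :=
    { toFun := Quot.lift (Sum.elim (fun k => Quot.mk _ (Quot.mk _ (Sum.inl k)))
        (Quot.lift (fun k => Quot.mk _ (Quot.mk _ (Sum.inr k))) (by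
          rintro _ _ ⟨rfl, rfl⟩
          exact Quot.sound ⟨rfl, rfl⟩))) (by
        rintro _ _ ⟨b⟩
        exact congrArg (Quot.mk _) (Quot.sound (Glue.mk (S := S) (T := T) b)))
      invFun := Quot.lift (Quot.lift (Sum.elim (fun k => Quot.mk _ (Sum.inl k))
          (fun k => Quot.mk _ (Sum.inr (Quot.mk _ k)))) (by
          rintro _ _ ⟨b⟩
          exact Quot.sound (Glue.mk (S := S) (T := T.tube p q) b))) (by
        rintro _ _ ⟨rfl, rfl⟩
        exact congrArg (fun z => Quot.mk _ (Sum.inr z)) (Quot.sound ⟨rfl, rfl⟩))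
      left_inv := by
        rintro ⟨k | k⟩
        · rfl
        · obtain ⟨k, rfl⟩ := Quot.exists_rep k
          rfl
      right_inv := by rintro ⟨⟨k | k⟩⟩ <;> rfl }
  refine ⟨e, genus_ext e fun w => ?_, fun _ => rfl, fun _ => rfl⟩
  refine (glue_sum _ _ fun c => w (e c)).trans ?_
  refine Eq.trans ?_ (tube_sum (S.glue T) _ _ w).symm
  refine (congrArg₂ (· + ·) (congrArg₂ (· + ·) rfl
    (tube_sum T p q fun c => w (e (Quot.mk _ (Sum.inr c))))) rfl).trans ?_
  refine Eq.trans ?_ (congrArg₂ (· + ·) (glue_sum S T fun c => w (Quot.mk _ c)).symm rfl)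
  have aux : ∀ a b c d : ℤ, a + (b + c) + d = a + b + d + c := by intros; ring
  exact aux _ _ _ _

theorem tube_glue (S : Surface A B) (T : Surface B C) (p q : S.K) :
    Homeo ((S.tube p q).glue T)
      ((S.glue T).tube (Quot.mk _ (Sum.inl p)) (Quot.mk _ (Sum.inl q))) := by
  let e : ((S.tube p q).glue T).K ≃
      ((S.glue T).tube (Quot.mk _ (Sum.inl p)) (Quot.mk _ (Sum.inl q))).K :=
    { toFun := Quot.lift (Sum.elim
        (Quot.lift (fun k => Quot.mk _ (Quot.mk _ (Sum.inl k))) (by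
          rintro _ _ ⟨rfl, rfl⟩
          exact Quot.sound ⟨rfl, rfl⟩))
        (fun k => Quot.mk _ (Quot.mk _ (Sum.inr k)))) (by
        rintro _ _ ⟨b⟩
        exact congrArg (Quot.mk _) (Quot.sound (Glue.mk (S := S) (T := T) b)))
      invFun := Quot.lift (Quot.lift (Sum.elim (fun k => Quot.mk _ (Sum.inl (Quot.mk _ k)))
          (fun k => Quot.mk _ (Sum.inr k))) (by
          rintro _ _ ⟨b⟩
          exact Quot.sound (Glue.mk (S := S.tube p q) (T := T) b))) (by
        rintro _ _ ⟨rfl, rfl⟩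
        exact congrArg (fun z => Quot.mk _ (Sum.inl z)) (Quot.sound ⟨rfl, rfl⟩))
      left_inv := by
        rintro ⟨k | k⟩
        · obtain ⟨k, rfl⟩ := Quot.exists_rep k
          rfl
        · rfl
      right_inv := by rintro ⟨⟨k | k⟩⟩ <;> rfl }
  refine ⟨e, genus_ext e fun w => ?_, fun _ => rfl, fun _ => rfl⟩
  refine (glue_sum _ _ fun c => w (e c)).trans ?_
  refine Eq.trans ?_ (tube_sum (S.glue T) _ _ w).symm
  refine (congrArg₂ (· + ·) (congrArg₂ (· + ·)
    (tube_sum S p q fun c => w (e (Quot.mk _ (Sum.inl c)))) rfl) rfl).trans ?_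
  refine Eq.trans ?_ (congrArg₂ (· + ·) (glue_sum S T fun c => w (Quot.mk _ c)).symm rfl)
  have aux : ∀ a b c d : ℤ, a + c + b + d = a + b + d + c := by intros; ring
  exact aux _ _ _ _

end gluing

/-- Gluing along no circles is disjoint union. -/
theorem glue_homeo_of_equiv (S : Surface A Empty) (T : Surface Empty C) {U : Surface A C}
    (e : S.K ⊕ T.K ≃ U.K) (hS : ∀ k, U.genus (e (Sum.inl k)) = S.genus k)
    (hT : ∀ k, U.genus (e (Sum.inr k)) = T.genus k)
    (hsrc : ∀ a, e (Sum.inl (S.src a)) = U.src a)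
    (htgt : ∀ c, e (Sum.inr (T.tgt c)) = U.tgt c) : Homeo (S.glue T) U := by
  let E : (S.glue T).K ≃ U.K :=
    { toFun := Quot.lift e (by rintro _ _ ⟨b⟩; exact b.elim)
      invFun := fun k => Quot.mk _ (e.symm k)
      left_inv := by
        intro x
        induction x using Quot.ind with
        | _ x => exact congrArg (Quot.mk _) (e.symm_apply_apply x)
      right_inv := fun x => e.apply_symm_apply x }
  refine ⟨E, genus_ext E fun w => ?_, hsrc, htgt⟩
  refine (glue_sum _ _ fun c => w (E c)).trans ?_
  rw [Finset.univ_eq_empty (α := Empty), Finset.sum_empty, add_zero, ← e.sum_comp,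
    Fintype.sum_sum_type]
  refine congrArg₂ (· + ·) (Finset.sum_congr rfl fun k _ => ?_)
    (Finset.sum_congr rfl fun k _ => ?_)
  · rw [excess, excess, hS]; rfl
  · rw [excess, excess, hT]; rfl

theorem euler_eq [Fintype A] [Fintype B] (S : Surface A B) :
    S.euler = -2 * (∑ k, S.excess k) - Fintype.card A - Fintype.card B := by
  rw [euler, Finset.mul_sum]
  congr 2
  refine Finset.sum_congr rfl fun k _ => ?_
  rw [excess]
  ring

theorem euler_glue [Fintype A] [Fintype B] [Fintype C] (S : Surface A B) (T : Surface B C) :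
    (S.glue T).euler = S.euler + T.euler := by
  have h := glue_sum S T fun _ => 1
  simp only [one_mul, Finset.sum_const, Finset.card_univ, nsmul_one] at h
  rw [euler_eq, euler_eq, euler_eq]
  refine (congrArg (fun z : ℤ => -2 * z - Fintype.card A - Fintype.card C) h).trans ?_
  ring

end Surface

/-! ### Values of closed surfaces -/

section evaluation

variable (R : Type u) [CommRing R]

/-- The value of a closed connected surface of genus `g`: zero if `g` is even, and `2 * T ^ k` if
`g = 2 * k + 1`. -/
noncomputable def genusValue (g : ℕ) : R[X] :=
  if Even g then 0 else 2 * X ^ (g / 2)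

theorem genusValue_even {g : ℕ} (h : Even g) : genusValue R g = 0 := if_pos h

theorem genusValue_odd (k : ℕ) : genusValue R (2 * k + 1) = 2 * X ^ k := by
  rw [genusValue, if_neg (by simp)]
  congr 2
  omega

theorem genusValue_add_two (g : ℕ) : genusValue R (g + 2) = genusValue R g * X := by
  rcases Nat.even_or_odd' g with ⟨k, rfl | rfl⟩
  · rw [genusValue_even R (even_two_mul k), genusValue_even R ⟨k + 1, by ring⟩, zero_mul]
  · rw [genusValue_odd, show 2 * k + 1 + 2 = 2 * (k + 1) + 1 by ring, genusValue_odd]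
    ring

/-- Neck-cutting for two closed connected surfaces. -/
theorem two_mul_genusValue_add (g h : ℕ) :
    2 * genusValue R (g + h) =
      genusValue R (g + 1) * genusValue R h + genusValue R g * genusValue R (h + 1) := by
  rcases Nat.even_or_odd' g with ⟨k, rfl | rfl⟩ <;> rcases Nat.even_or_odd' h with ⟨l, rfl | rfl⟩
  · simp only [genusValue_even R (show Even (2 * k + 2 * l) from ⟨k + l, by ring⟩),
      genusValue_even R (even_two_mul _)]
    ring
  · rw [show 2 * k + (2 * l + 1) = 2 * (k + l) + 1 by ring]
    simp only [genusValue_odd, genusValue_even R (even_two_mul _)]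
    ring
  · rw [show 2 * k + 1 + 2 * l = 2 * (k + l) + 1 by ring]
    simp only [genusValue_odd, genusValue_even R (even_two_mul _)]
    ring
  · rw [show 2 * k + 1 + (2 * l + 1) = 2 * (k + l + 1) by ring,
      show 2 * k + 1 + 1 = 2 * (k + 1) by ring, show 2 * l + 1 + 1 = 2 * (l + 1) by ring]
    simp only [genusValue_even R (even_two_mul _)]
    ring

/-- The value of a closed surface, the product over its components. -/
noncomputable def closedValue (S : Surface Empty Empty) : R[X] := ∏ k, genusValue R (S.genus k)

variable {R}

theorem closedValue_congr {S T : Surface Empty Empty} (h : S.Homeo T) :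
    closedValue R S = closedValue R T := by
  obtain ⟨e, h1, -, -⟩ := h
  rw [closedValue, closedValue, ← e.prod_comp]
  simp only [h1]

theorem closedValue_addClosed (S : Surface Empty Empty) (n : ℕ) :
    closedValue R (S.addClosed n) = genusValue R n * closedValue R S :=
  Fintype.prod_option (fun k : Option S.K => genusValue R ((S.addClosed n).genus k))

open Classical in
/-- Removing one component from a closed surface. -/
noncomputable def Surface.erase (S : Surface Empty Empty) (p : S.K) : Surface Empty Empty where
  K := {k : S.K // k ≠ p}
  genus k := S.genus k
  src := Empty.elim
  tgt := Empty.elim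

theorem Surface.homeo_erase_addClosed (S : Surface Empty Empty) (p : S.K) :
    S.Homeo ((S.erase p).addClosed (S.genus p)) := by
  classical
  refine Surface.Homeo.symm ⟨Equiv.optionSubtypeNe p, ?_, fun a => a.elim, fun a => a.elim⟩
  rintro (_ | k)
  · exact congrArg S.genus (Equiv.optionSubtypeNe_none p)
  · exact congrArg S.genus (Equiv.optionSubtypeNe_some p k)

theorem closedValue_erase (S : Surface Empty Empty) (p : S.K) :
    closedValue R S = genusValue R (S.genus p) * closedValue R (S.erase p) :=
  (closedValue_congr (S.homeo_erase_addClosed p)).trans (closedValue_addClosed _ _)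

/-- Neck cutting for the values of closed surfaces. -/
theorem two_mul_closedValue_tube (S : Surface Empty Empty) (p q : S.K) :
    2 * closedValue R (S.tube p q) = closedValue R (S.handle p) + closedValue R (S.handle q) := by
  classical
  by_cases hpq : p = q
  · subst hpq
    rw [closedValue_congr (S.tube_self p)]
    ring
  · let P : R[X] := ∏ k ∈ (Finset.univ.erase p).erase q, genusValue R (S.genus k)
    have hq : q ∈ (Finset.univ.erase p : Finset S.K) := by simp [Ne.symm hpq]
    have hprod : ∀ f : S.K → R[X],
        ∏ k, f k = f p * (f q * ∏ k ∈ (Finset.univ.erase p).erase q, f k) := by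
      intro f
      rw [Finset.mul_prod_erase _ f hq, Finset.mul_prod_erase _ f (Finset.mem_univ p)]
    have hP : ∀ (g : S.K → ℕ), (∀ k, k ≠ p → k ≠ q → g k = S.genus k) →
        ∏ k ∈ (Finset.univ.erase p).erase q, genusValue R (g k) = P := by
      intro g hg
      refine Finset.prod_congr rfl fun k hk => ?_
      simp only [Finset.mem_erase] at hk
      rw [hg k hk.2.1 hk.1]
    have hhp : closedValue R (S.handle p) =
        genusValue R (S.genus p + 1) * (genusValue R (S.genus q) * P) := by
      refine (hprod fun k => genusValue R ((S.handle p).genus k)).trans ?_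
      rw [hP (fun k => (S.handle p).genus k) (fun k h1 _ => by simp [Surface.handle, h1])]
      simp [Surface.handle, Ne.symm hpq]
    have hhq : closedValue R (S.handle q) =
        genusValue R (S.genus p) * (genusValue R (S.genus q + 1) * P) := by
      refine (hprod fun k => genusValue R ((S.handle q).genus k)).trans ?_
      rw [hP (fun k => (S.handle q).genus k) (fun k _ h1 => by simp [Surface.handle, h1])]
      simp [Surface.handle, hpq]
    -- The result of the tube, with `q` removed and its genus added to that of `p`.
    let M : Surface Empty Empty :=
      { K := {k : S.K // k ≠ q}
        genus := fun k => S.genus k + if k.1 = p then S.genus q else 0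
        src := Empty.elim
        tgt := Empty.elim }
    have hM : (S.tube p q).Homeo M := by
      refine Surface.tube_homeo (T := M) (fun k => if h : k = q then ⟨p, hpq⟩ else ⟨k, h⟩) ?_
        (fun k => k.1) ?_ ?_ ?_ (fun a => a.elim) (fun a => a.elim)
      · simp [hpq]
      · rintro ⟨k, hk⟩
        simp [hk]
      · intro k
        by_cases hk : k = q
        · exact Or.inr ⟨by simp [hk], hk⟩
        · exact Or.inl (by simp [hk])
      · intro w
        have hw : ∀ k : M.K, w k * M.excess k = w k * S.excess k.1 +
            if k.1 = p then w k * S.genus q else 0 := by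
          intro k
          have : M.excess k = ((S.genus k.1 + if k.1 = p then S.genus q else 0 : ℕ) : ℤ) - 1 := rfl
          rw [this]
          by_cases hk : k.1 = p
          · rw [if_pos hk, if_pos hk, Surface.excess]
            push_cast
            ring
          · rw [if_neg hk, if_neg hk, Surface.excess]
            push_cast
            ring
        have hsingle : ∑ k : M.K, (if k.1 = p then w k * S.genus q else 0) =
            w ⟨p, hpq⟩ * S.genus q := by
          refine (Finset.sum_eq_single_of_mem (⟨p, hpq⟩ : M.K) (Finset.mem_univ _) fun k _ hk =>
            if_neg fun h => hk (Subtype.ext h)).trans (if_pos rfl)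
        simp only [hw, Finset.sum_add_distrib, hsingle]
        let F : S.K → ℤ := fun k =>
          w (if h : k = q then ⟨p, hpq⟩ else ⟨k, h⟩) * S.excess k
        have hF : ∑ k : M.K, w k * S.excess k.1 = ∑ k ∈ Finset.univ.erase q, F k := by
          rw [Finset.sum_subtype (p := fun k => k ≠ q) (Finset.univ.erase q) (by simp) F]
          refine Finset.sum_congr rfl fun k _ => ?_
          simp only [F]
          rw [dif_neg k.2]
        rw [hF, ← Finset.add_sum_erase _ F (Finset.mem_univ q)]
        simp only [F, dif_pos, dif_neg hpq, Surface.excess]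
        ring
    have hMv : closedValue R M = genusValue R (S.genus p + S.genus q) * P := by
      let F : S.K → R[X] := fun k => genusValue R (S.genus k + if k = p then S.genus q else 0)
      have h1 : closedValue R M = ∏ k ∈ Finset.univ.erase q, F k :=
        (Finset.prod_subtype (p := fun k => k ≠ q) (Finset.univ.erase q) (by simp) F).symm
      have hp : p ∈ (Finset.univ.erase q : Finset S.K) := by simp [hpq]
      rw [h1, ← Finset.mul_prod_erase _ F hp, Finset.erase_right_comm]
      congr 1
      · simp [F]
      · exact hP (fun k => S.genus k + if k = p then S.genus q else 0)
          (fun k h _ => by simp [h])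
    rw [closedValue_congr hM, hMv, hhp, hhq, ← mul_assoc, two_mul_genusValue_add]
    ring

theorem closedValue_fourTube [Invertible (2 : R)] (S : Surface Empty Empty) (p q r s : S.K) :
    closedValue R (S.tube p q) + closedValue R (S.tube r s) - closedValue R (S.tube p r) -
      closedValue R (S.tube q s) = 0 := by
  have h2 : IsUnit (2 : R[X]) := by
    have := (isUnit_of_invertible (2 : R)).map (C : R →+* R[X])
    rwa [map_ofNat] at this
  refine h2.mul_left_cancel ?_
  have h : ∀ a b c d : R[X], 2 * (a + b - c - d) = 2 * a + 2 * b - 2 * c - 2 * d := by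
    intros; ring
  rw [h]
  simp only [two_mul_closedValue_tube]
  ring

variable (R) in
/-- The linear extension of the value of closed surfaces to formal combinations. -/
noncomputable def comboValue : Combo R Empty Empty →ₗ[R] R[X] :=
  Finsupp.linearCombination R
    (Quotient.lift (closedValue R) fun _ _ h => closedValue_congr h : Cobordism Empty Empty → R[X])

theorem comboValue_surf (S : Surface Empty Empty) :
    comboValue R (surf R S) = closedValue R S :=
  (Finsupp.linearCombination_single R _ _).trans (one_smul R _)

theorem comboComp_surf {A B E : Type} [Fintype B] (S : Surface A B) (T : Surface B E) :
    comboComp (surf R S) (surf R T) = surf R (S.glue T) := by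
  rw [surf, surf, comboComp_single, mul_one]
  rfl

theorem surf_eq {A B : Type} {S T : Surface A B} (h : S.Homeo T) : surf R S = surf R T := by
  unfold surf Cobordism.of
  rw [Quotient.sound h]

theorem combo_induction {A B : Type} {P : Combo R A B → Prop} (h0 : P 0)
    (hadd : ∀ f g, P f → P g → P (f + g)) (hsurf : ∀ (r : R) S, P (r • surf R S))
    (f : Combo R A B) : P f := by
  induction f using Finsupp.induction_linear with
  | zero => exact h0
  | add f g hf hg => exact hadd f g hf hg
  | single f r =>
    induction f using Quotient.inductionOn with
    | _ S =>
      have := hsurf r S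
      rwa [surf, Finsupp.smul_single_one] at this

theorem comboValue_localRel [Invertible (2 : R)] {A B : Type} [Fintype A] [Fintype B]
    (F : Surface Empty A) (G : Surface B Empty) {y : Combo R A B} (hy : LocalRel R y) :
    comboValue R (comboComp (comboComp (surf R F) y) (surf R G)) = 0 := by
  have hadd : ∀ (S : Surface A B) (n : ℕ), comboValue R (comboComp (comboComp (surf R F)
      (surf R (S.addClosed n))) (surf R G)) =
      genusValue R n * closedValue R ((F.glue S).glue G) := by
    intro S n
    rw [comboComp_surf, surf_eq (F.glue_addClosed S n), comboComp_surf,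
      surf_eq (Surface.addClosed_glue _ G n), comboValue_surf, closedValue_addClosed]
  cases hy with
  | sphere S => rw [hadd, genusValue_even R (by simp), zero_mul]
  | torus S =>
    have h1 : genusValue R 1 = 2 := by
      have := genusValue_odd R 0
      simpa using this
    simp only [map_sub, map_smul, LinearMap.sub_apply, LinearMap.smul_apply]
    rw [hadd, h1, comboComp_surf, comboComp_surf, comboValue_surf, smul_eq_C_mul, map_ofNat,
      sub_self]
  | fourTube S p q r s =>
    have htube : ∀ p q : S.K, comboValue R (comboComp (comboComp (surf R F)
        (surf R (S.tube p q))) (surf R G)) =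
        closedValue R (((F.glue S).glue G).tube (Quot.mk _ (Sum.inl (Quot.mk _ (Sum.inr p))))
          (Quot.mk _ (Sum.inl (Quot.mk _ (Sum.inr q))))) := by
      intro p q
      rw [comboComp_surf, surf_eq (F.glue_tube S p q), comboComp_surf]
      exact (congrArg (comboValue R) (surf_eq (Surface.tube_glue (F.glue S) G _ _))).trans
        (comboValue_surf _)
    simp only [map_sub, map_add, LinearMap.sub_apply, LinearMap.add_apply, htube]
    exact closedValue_fourTube _ _ _ _ _

/-- The values of closed surfaces respect the local relations. -/
theorem relIdeal_le_ker [Invertible (2 : R)] :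
    relIdeal R Empty Empty ≤ LinearMap.ker (comboValue R) := by
  refine Submodule.span_le.2 ?_
  rintro _ ⟨A, B, _, _, f, y, g, hy, rfl⟩
  rw [SetLike.mem_coe, LinearMap.mem_ker]
  induction f using combo_induction with
  | h0 => simp
  | hadd f f' hf hf' => simp only [map_add, LinearMap.add_apply, hf, hf', add_zero]
  | hsurf r F =>
    induction g using combo_induction with
    | h0 => simp
    | hadd g g' hg hg' => simp only [map_add, hg, hg', add_zero]
    | hsurf s G =>
      simp only [map_smul, LinearMap.smul_apply, comboValue_localRel F G hy, smul_zero]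

/-- The value of a morphism between empty collections of circles, the linear extension of
`closedValue`. -/
noncomputable def value [Invertible (2 : R)] (m n : ℤ) :
    (Cob.empty R m ⟶ Cob.empty R n) →ₗ[R] R[X] :=
  Submodule.liftQ (relIdeal R Empty Empty) (comboValue R) relIdeal_le_ker

theorem value_ofSurface [Invertible (2 : R)] (m n : ℤ) (S : Surface Empty Empty) :
    value m n (Cob.ofSurface S : Cob.empty R m ⟶ Cob.empty R n) = closedValue R S :=
  comboValue_surf S

theorem closedValue_genusThree (k : ℕ) : closedValue R (genusThree k) = (2 * X) ^ k := by
  have h : genusValue R 3 = 2 * X := by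
    have := genusValue_odd R 1
    simpa using this
  refine (Finset.prod_const (ι := Fin k) (s := Finset.univ) (genusValue R 3)).trans ?_
  rw [h, Finset.card_univ, Fintype.card_fin]

theorem value_closedSurfaces [Invertible (2 : R)] (m n : ℤ) (p : R[X]) :
    value m n (closedSurfaces R m n p) = p := by
  induction p using Polynomial.induction_on' with
  | add p q hp hq => rw [map_add, map_add, hp, hq]
  | monomial k a =>
    rw [closedSurfaces_monomial, map_smul, value_ofSurface, closedValue_genusThree, mul_pow,
      ← map_ofNat C 2, ← C_pow, C_mul_X_pow_eq_monomial, smul_monomial]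
    congr 1
    rw [smul_eq_mul, mul_right_comm, ← mul_pow, invOf_mul_self, one_pow, one_mul]

end evaluation

/-! ### Consequences of the local relations -/

namespace Cob

variable {R : Type u} [CommRing R] {X Y : Cob R}

theorem cls_localRel {x : Combo R X.circles Y.circles} (hx : LocalRel R x) : cls X Y x = 0 := by
  refine cls_eq_zero.2 (Submodule.subset_span ⟨_, _, inferInstance, inferInstance,
    surf R (Surface.cylinder X.circles), x, surf R (Surface.cylinder Y.circles), hx, ?_⟩)
  rw [comboComp_id, id_comboComp]

theorem ofSurface_addClosed_zero (S : Surface X.circles Y.circles) :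
    (ofSurface (S.addClosed 0) : X ⟶ Y) = 0 :=
  cls_localRel (LocalRel.sphere S)

theorem ofSurface_addClosed_one (S : Surface X.circles Y.circles) :
    (ofSurface (S.addClosed 1) : X ⟶ Y) = (2 : R) • ofSurface S := by
  have h := cls_localRel (X := X) (Y := Y) (LocalRel.torus S)
  rw [map_sub, map_smul] at h
  exact sub_eq_zero.1 h

theorem ofSurface_fourTube (S : Surface X.circles Y.circles) (p q r s : S.K) :
    (ofSurface (S.tube p q) : X ⟶ Y) + ofSurface (S.tube r s) =
      ofSurface (S.tube p r) + ofSurface (S.tube q s) := by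
  have h := cls_localRel (X := X) (Y := Y) (LocalRel.fourTube S p q r s)
  rw [map_sub, map_sub, map_add, sub_sub] at h
  exact sub_eq_zero.1 h

/-- The four tube relation with two of the four discs on an additional torus. -/
theorem ofSurface_tube_add_genusTwo (S : Surface X.circles Y.circles) (p q : S.K) :
    (2 : R) • (ofSurface (S.tube p q) : X ⟶ Y) + ofSurface (S.addClosed 2) =
      ofSurface (S.handle p) + ofSurface (S.handle q) := by
  have h := ofSurface_fourTube (X := X) (Y := Y) (S.addClosed 1) (some p) (some q) none none
  have h2 : ((S.addClosed 1).tube none none).Homeo (S.addClosed 2) :=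
    (Surface.tube_self (S.addClosed 1) none).trans (S.handle_addClosed_none 1)
  rwa [ofSurface_eq (S.tube_addClosed_some 1 p q), ofSurface_addClosed_one, ofSurface_eq h2,
    ofSurface_eq (S.tube_addClosed_one p), ofSurface_eq (S.tube_addClosed_one q)] at h

variable [Invertible (2 : R)]

theorem two_smul_cancel {f g : X ⟶ Y} (h : (2 : R) • f = (2 : R) • g) : f = g := by
  rw [← one_smul R f, ← one_smul R g, ← invOf_mul_self (2 : R), mul_smul, mul_smul, h]

/-- Components of genus two vanish, by neck cutting on a torus component. -/
theorem ofSurface_addClosed_two (S : Surface X.circles Y.circles) :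
    (ofSurface (S.addClosed 2) : X ⟶ Y) = 0 := by
  -- Both sides contain twice the torus with one handle added; what remains on the left is the union
  -- of a torus and a surface of genus two.
  have h := ofSurface_tube_add_genusTwo (X := X) (Y := Y) (S.addClosed 1) none none
  rw [ofSurface_eq (Surface.tube_self (S.addClosed 1) none), two_smul, add_eq_left,
    ofSurface_eq (S.addClosed_comm 1 2), ofSurface_addClosed_one] at h
  exact two_smul_cancel (h.trans (smul_zero _).symm)

/-- Neck cutting: twice a tube is a handle at its one end plus a handle at its other end. -/
theorem two_smul_ofSurface_tube (S : Surface X.circles Y.circles) (p q : S.K) :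
    (2 : R) • (ofSurface (S.tube p q) : X ⟶ Y) =
      ofSurface (S.handle p) + ofSurface (S.handle q) := by
  rw [← ofSurface_tube_add_genusTwo, ofSurface_addClosed_two, add_zero]

/-- Two handles on a closed component may be traded for one half of a component of genus three. -/
theorem two_smul_ofSurface_addClosed_add_two (S : Surface X.circles Y.circles) (g : ℕ) :
    (2 : R) • (ofSurface (S.addClosed (g + 2)) : X ⟶ Y) =
      ofSurface ((S.addClosed g).addClosed 3) := by
  have h := two_smul_ofSurface_tube (X := X) (Y := Y) ((S.addClosed g).addClosed 2)
    (some none) none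
  rwa [ofSurface_eq (S.tube_addClosed_addClosed g 2),
    ofSurface_eq (Surface.handle_addClosed_some (S.addClosed g) 2 none),
    ofSurface_addClosed_two, zero_add,
    ofSurface_eq (Surface.handle_addClosed_none (S.addClosed g) 2)] at h

end Cob

/-! ### Fullness and faithfulness of the realization -/

section full

variable {R : Type u} [CommRing R]

/-- The linear map with given matrix entries. -/
noncomputable def FreeMod.ofEntries {F G : FreeMod R} (a : F.ι → G.ι → R[X]) : F ⟶ G :=
  show F.Carrier →ₗ[R[X]] G.Carrier from
    LinearMap.pi fun j => ∑ i, (LinearMap.proj i).smulRight (a i j)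

theorem FreeMod.entry_ofEntries {F G : FreeMod R} (a : F.ι → G.ι → R[X]) (i : F.ι) (j : G.ι) :
    FreeMod.entry (FreeMod.ofEntries a) i j = a i j := by
  classical
  change (∑ i', (LinearMap.proj (R := R[X]) i').smulRight (a i' j) :
    (F.ι → R[X]) →ₗ[R[X]] R[X]) (Pi.single i 1) = _
  rw [LinearMap.sum_apply, Finset.sum_eq_single i]
  · simp
  · intro b _ hb
    simp [hb]
  · simp

theorem FreeMod.hom_ext {F G : FreeMod R} {f g : F ⟶ G}
    (h : ∀ i j, FreeMod.entry f i j = FreeMod.entry g i j) : f = g := by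
  classical
  refine LinearMap.pi_ext' (R := R[X]) (φ := fun _ : F.ι => R[X]) fun i => ?_
  refine LinearMap.ext_ring (funext fun j => ?_)
  refine Eq.trans ?_ ((h i j).trans ?_)
  · simp [FreeMod.entry]
  · simp [FreeMod.entry]

variable [Invertible (2 : R)]

theorem glue_genusThree_one (S : Surface Empty Empty) :
    (S.glue (genusThree 1)).Homeo (S.addClosed 3) := by
  let e : S.K ⊕ Fin 1 ≃ Option S.K :=
    { toFun := Sum.elim some fun _ => none
      invFun := fun k => k.elim (Sum.inr 0) Sum.inl
      left_inv := by
        rintro (k | k)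
        · rfl
        · exact congrArg Sum.inr (Subsingleton.elim _ _)
      right_inv := by rintro (_ | k) <;> rfl }
  exact Surface.glue_homeo_of_equiv S (genusThree 1) (U := S.addClosed 3) e (fun _ => rfl)
    (fun _ => rfl) (fun a => a.elim) (fun a => a.elim)

theorem closedSurfaces_X (m n : ℤ) :
    closedSurfaces R m n (2 * X) = Cob.ofSurface (genusThree 1) := by
  rw [← map_ofNat C 2, ← pow_one (X : R[X]), C_mul_X_pow_eq_monomial, closedSurfaces_monomial,
    pow_one, invOf_mul_self, one_smul]

/-- In the presence of a surface that is a combination of surfaces of genus three, so is any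
further closed connected component. -/
theorem ofSurface_addClosed (m n : ℤ) {S : Surface Empty Empty} {P : R[X]}
    (hS : (Cob.ofSurface S : Cob.empty R m ⟶ Cob.empty R n) = closedSurfaces R m n P) (g : ℕ) :
    (Cob.ofSurface (S.addClosed g) : Cob.empty R m ⟶ Cob.empty R n) =
      closedSurfaces R m n (P * genusValue R g) := by
  induction g using Nat.twoStepInduction with
  | zero =>
    rw [genusValue_even R Even.zero, mul_zero, map_zero]
    exact Cob.ofSurface_addClosed_zero (X := Cob.empty R m) (Y := Cob.empty R n) S
  | one =>
    have h1 : genusValue R 1 = 2 := by simpa using genusValue_odd R 0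
    rw [h1, mul_comm, ← map_ofNat C 2, ← smul_eq_C_mul, map_smul, ← hS]
    exact Cob.ofSurface_addClosed_one (X := Cob.empty R m) (Y := Cob.empty R n) S
  | more g ih _ =>
    refine Cob.two_smul_cancel ((Cob.two_smul_ofSurface_addClosed_add_two
      (X := Cob.empty R m) (Y := Cob.empty R n) S g).trans ?_)
    have h1 : (Cob.ofSurface ((S.addClosed g).glue (genusThree 1)) :
        Cob.empty R m ⟶ Cob.empty R n) = Cob.ofSurface ((S.addClosed g).addClosed 3) :=
      Cob.ofSurface_eq (X := Cob.empty R m) (Y := Cob.empty R n) (glue_genusThree_one _)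
    have h2 := Cob.ofSurface_comp (X := Cob.empty R m) (Y := Cob.empty R n) (Z := Cob.empty R n)
      (S.addClosed g) (genusThree 1)
    rw [← h1, ← h2, ih, ← closedSurfaces_X, closedSurfaces_mul, ← map_smul, smul_eq_C_mul,
      map_ofNat, genusValue_add_two]
    congr 1
    ring

/-- Modulo the local relations, every closed surface is determined by its value. -/
theorem ofSurface_eq_closedSurfaces (m n : ℤ) (S : Surface Empty Empty) :
    (Cob.ofSurface S : Cob.empty R m ⟶ Cob.empty R n) =
      closedSurfaces R m n (closedValue R S) := by
  induction hN : Fintype.card S.K generalizing S with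
  | zero =>
    have hK := Fintype.card_eq_zero_iff.1 hN
    have h0 : S.Homeo (genusThree 0) := ⟨Equiv.equivOfIsEmpty S.K (Fin 0),
      fun k => isEmptyElim k, fun a => a.elim, fun a => a.elim⟩
    rw [closedValue_congr h0, closedValue_genusThree, pow_zero, ← monomial_zero_one,
      closedSurfaces_monomial, pow_zero, one_mul, one_smul]
    exact Cob.ofSurface_eq (X := Cob.empty R m) (Y := Cob.empty R n) h0
  | succ N ih =>
    obtain ⟨p⟩ : Nonempty S.K := Fintype.card_pos_iff.1 (by omega)
    have hcard : Fintype.card (S.erase p).K = N := by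
      classical
      refine (Fintype.card_subtype_compl fun k => k = p).trans ?_
      simp [hN]
    rw [closedValue_erase S p, mul_comm, ← ofSurface_addClosed m n (ih (S.erase p) hcard)]
    exact Cob.ofSurface_eq (X := Cob.empty R m) (Y := Cob.empty R n) (S.homeo_erase_addClosed p)

theorem closedSurfaces_value (m n : ℤ) (f : Cob.empty R m ⟶ Cob.empty R n) :
    closedSurfaces R m n (value m n f) = f := by
  obtain ⟨f, rfl⟩ := Cob.cls_surjective (Cob.empty R m) (Cob.empty R n) f
  induction f using combo_induction with
  | h0 => simp only [map_zero]
  | hadd f g hf hg =>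
    rw [map_add]
    exact (congrArg _ (map_add (value m n) _ _)).trans
      ((map_add _ _ _).trans (congrArg₂ (· + ·) hf hg))
  | hsurf r S =>
    rw [map_smul]
    refine (congrArg _ (map_smul (value m n) r _)).trans ((map_smul _ _ _).trans ?_)
    congr 1
    exact (congrArg _ (value_ofSurface m n S)).trans (ofSurface_eq_closedSurfaces m n S).symm

instance realize_full : (realize R).Full where
  map_surjective {F G} f :=
    ⟨FreeMod.ofEntries fun i j => value (F.deg i) (G.deg j) (f i j), by
      ext i j
      refine (congrArg (closedSurfaces R (F.deg i) (G.deg j))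
        (FreeMod.entry_ofEntries _ i j)).trans ?_
      exact closedSurfaces_value _ _ _⟩

instance realize_faithful : (realize R).Faithful where
  map_injective {F G} f g h := by
    refine FreeMod.hom_ext fun i j => ?_
    have h1 := congrArg (value (F.deg i) (G.deg j)) (congrFun (congrFun h i) j)
    exact (value_closedSurfaces _ _ _).symm.trans (h1.trans (value_closedSurfaces _ _ _))

theorem entry_of_realize_map {F G : FreeMod R} (f : F ⟶ G) (i : F.ι) (j : G.ι) :
    FreeMod.entry f i j = value (F.deg i) (G.deg j) ((realize R).map f i j) :=
  (value_closedSurfaces _ _ _).symm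

end full

/-! ### Cutting cylinders into caps -/

namespace Surface

variable {A : Type}

/-- Every incoming circle bounds its own component; the one at the circle `a` has genus `g a`. -/
def capIn [Fintype A] (g : A → ℕ) : Surface A Empty where
  K := A
  genus := g
  src a := a
  tgt := Empty.elim

/-- Every outgoing circle bounds its own component; the one at the circle `a` has genus `g a`. -/
def capOut [Fintype A] (g : A → ℕ) : Surface Empty A where
  K := A
  genus := g
  src := Empty.elim
  tgt a := a

/-- The disjoint union of closed connected surfaces of genera `g a`. -/
def closedUnion [Fintype A] (g : A → ℕ) : Surface Empty Empty where
  K := A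
  genus := g
  src := Empty.elim
  tgt := Empty.elim

theorem capOut_glue_capIn [Fintype A] (g g' : A → ℕ) :
    ((capOut g).glue (capIn g')).Homeo (closedUnion fun a => g a + g' a) := by
  let e : ((capOut g).glue (capIn g')).K ≃ A :=
    { toFun := Quot.lift (Sum.elim (fun a => a) fun a => a) (by rintro _ _ ⟨b⟩; rfl)
      invFun := fun a => Quot.mk _ (Sum.inl a)
      left_inv := by
        rintro ⟨a | a⟩
        · rfl
        · exact Quot.sound (Glue.mk (S := capOut g) (T := capIn g') a)
      right_inv := fun _ => rfl }
  refine ⟨e, genus_ext (T := closedUnion fun a => g a + g' a) e fun w => ?_, fun a => a.elim,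
    fun a => a.elim⟩
  refine (glue_sum _ _ fun c => w (e c)).trans ?_
  have h : ∀ v : A → ℤ, ∑ a, v a * (((g a + g' a : ℕ) : ℤ) - 1) =
      ∑ a, v a * ((g a : ℤ) - 1) + ∑ a, v a * ((g' a : ℤ) - 1) + ∑ a, v a := by
    intro v
    rw [← Finset.sum_add_distrib, ← Finset.sum_add_distrib]
    refine Finset.sum_congr rfl fun a _ => ?_
    push_cast
    ring
  exact (h w).symm

open Classical in
/-- The piece on which the outgoing circle `a` lies after the cylinders over `U` are cut. -/
noncomputable def cutTgt (U : Finset A) (a : A) : A ⊕ {a // a ∈ U} :=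
  if h : a ∈ U then Sum.inr ⟨a, h⟩ else Sum.inl a

theorem cutTgt_of_mem {U : Finset A} {a : A} (h : a ∈ U) : cutTgt U a = Sum.inr ⟨a, h⟩ :=
  dif_pos h

theorem cutTgt_of_notMem {U : Finset A} {a : A} (h : a ∉ U) : cutTgt U a = Sum.inl a :=
  dif_neg h

/-- The cylinders over `A`, with the ones over the circles in `U` cut into two caps. The genera are
`g` on the incoming and `g'` on the outgoing side of the cut. -/
noncomputable def cut [Fintype A] (U : Finset A) (g g' : A → ℕ) : Surface A A where
  K := A ⊕ {a // a ∈ U}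
  genus := Sum.elim g fun a => g' a.1
  src := Sum.inl
  tgt := cutTgt U

theorem cut_homeo [Fintype A] {U : Finset A} {g g' h h' : A → ℕ} (hg : ∀ a, h a = g a)
    (hg' : ∀ a ∈ U, h' a = g' a) : (cut U g g').Homeo (cut U h h') := by
  refine ⟨Equiv.refl _, ?_, fun _ => rfl, fun _ => rfl⟩
  rintro (a | a)
  exacts [hg a, hg' a.1 a.2]

theorem cut_empty [Fintype A] (g' : A → ℕ) :
    (cut ∅ (fun _ => 0) g').Homeo (cylinder A) := by
  let e : A ⊕ {a : A // a ∈ (∅ : Finset A)} ≃ A :=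
    { toFun := Sum.elim (fun a => a) fun a => a.1
      invFun := Sum.inl
      left_inv := by
        rintro (a | a)
        · rfl
        · exact absurd a.2 (Finset.notMem_empty _)
      right_inv := fun _ => rfl }
  refine ⟨e, ?_, fun _ => rfl, fun a => ?_⟩
  · rintro (a | a)
    · rfl
    · exact absurd a.2 (Finset.notMem_empty _)
  · exact congrArg e (cutTgt_of_notMem (Finset.notMem_empty a))

theorem capIn_glue_capOut [Fintype A] (g g' : A → ℕ) :
    ((capIn g).glue (capOut g')).Homeo (cut Finset.univ g g') := by
  refine glue_homeo_of_equiv _ _ (U := cut Finset.univ g g')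
    (Equiv.sumCongr (Equiv.refl A) (Equiv.subtypeUnivEquiv (fun a => Finset.mem_univ a)).symm)
    (fun _ => rfl) (fun _ => rfl) (fun _ => rfl) fun a => ?_
  exact (cutTgt_of_mem (Finset.mem_univ a)).symm

open Classical in
/-- A tube between the two caps at the circle `a` undoes the cut at `a`. -/
theorem cut_insert_tube [Fintype A] {U : Finset A} {a : A} (ha : a ∉ U) {g g' : A → ℕ}
    (hg' : g' a = 0) :
    ((cut (insert a U) g g').tube (Sum.inl a) (Sum.inr ⟨a, Finset.mem_insert_self a U⟩)).Homeo
      (cut U g g') := by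
  let f : A ⊕ {b // b ∈ insert a U} → A ⊕ {b // b ∈ U} := Sum.elim Sum.inl fun b => cutTgt U b.1
  let i : A ⊕ {b // b ∈ U} → A ⊕ {b // b ∈ insert a U} :=
    Sum.map id fun b => ⟨b.1, Finset.mem_insert_of_mem b.2⟩
  refine tube_homeo (S := cut (insert a U) g g') (T := cut U g g') f
    (cutTgt_of_notMem ha).symm i ?_ ?_ ?_ (fun _ => rfl) ?_
  · rintro (b | b)
    · rfl
    · exact cutTgt_of_mem b.2
  · rintro (b | ⟨b, hb⟩)
    · exact Or.inl rfl
    · by_cases h : b ∈ U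
      · exact Or.inl (congrArg i (cutTgt_of_mem h))
      · obtain rfl : b = a := (Finset.mem_insert.1 hb).resolve_right h
        exact Or.inr ⟨congrArg i (cutTgt_of_notMem h), rfl⟩
  · intro w
    let F : A → ℤ := fun b => w (cutTgt U b) * ((g' b : ℤ) - 1)
    have h1 : ∑ k, w (f k) * (cut (insert a U) g g').excess k =
        ∑ b, w (Sum.inl b) * ((g b : ℤ) - 1) + ∑ b ∈ insert a U, F b := by
      refine (Fintype.sum_sum_type _).trans (congrArg₂ (· + ·) rfl ?_)
      exact Finset.sum_coe_sort (insert a U) F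
    have h2 : ∑ k, w k * (cut U g g').excess k =
        ∑ b, w (Sum.inl b) * ((g b : ℤ) - 1) + ∑ b ∈ U, F b := by
      refine (Fintype.sum_sum_type _).trans (congrArg₂ (· + ·) rfl ?_)
      refine Eq.trans (Finset.sum_congr rfl fun b _ => ?_) (Finset.sum_coe_sort U F)
      exact congrArg (fun k => w k * ((g' b.1 : ℤ) - 1)) (cutTgt_of_mem b.2).symm
    have h3 : F a = - w (Sum.inl a) := by
      refine (congrArg₂ (fun k (n : ℕ) => w k * ((n : ℤ) - 1)) (cutTgt_of_notMem ha) hg').trans ?_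
      exact mul_neg_one _
    refine (congrArg (· + w (Sum.inl a)) h1).trans (Eq.trans ?_ h2.symm)
    rw [Finset.sum_insert ha, h3]
    ring
  · intro b
    by_cases hb : b ∈ U
    · exact congrArg f (cutTgt_of_mem (Finset.mem_insert_of_mem hb))
    · by_cases hba : b = a
      · subst hba
        exact congrArg f (cutTgt_of_mem (Finset.mem_insert_self b U))
      · have : b ∉ insert a U := by simp [hba, hb]
        exact (congrArg f (cutTgt_of_notMem this)).trans (cutTgt_of_notMem hb).symm

theorem cut_handle_inl [Fintype A] {U : Finset A} {a : A} {g g' h h' : A → ℕ}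
    (ha : h a = g a + 1) (hg : ∀ b, b ≠ a → h b = g b) (hg' : ∀ b ∈ U, h' b = g' b) :
    ((cut U g g').handle (Sum.inl a)).Homeo (cut U h h') := by
  refine handle_homeo (S := cut U g g') (T := cut U h h') (Equiv.refl _) ha ?_ (fun _ => rfl)
    (fun _ => rfl)
  rintro (b | b) hb
  · exact hg b fun hba => hb (congrArg Sum.inl hba)
  · exact hg' b.1 b.2

theorem cut_handle_inr [Fintype A] {U : Finset A} {a : A} (haU : a ∈ U) {g g' h h' : A → ℕ}
    (ha : h' a = g' a + 1) (hg : ∀ b, h b = g b) (hg' : ∀ b ∈ U, b ≠ a → h' b = g' b) :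
    ((cut U g g').handle (Sum.inr ⟨a, haU⟩)).Homeo (cut U h h') := by
  refine handle_homeo (S := cut U g g') (T := cut U h h') (Equiv.refl _) ha ?_ (fun _ => rfl)
    (fun _ => rfl)
  rintro (b | b) hb
  · exact hg b
  · exact hg' b.1 b.2 fun hba => hb (congrArg Sum.inr (Subtype.ext hba))

theorem euler_capIn [Fintype A] (g : A → ℕ) : (capIn g).euler = ∑ a, (1 - 2 * (g a : ℤ)) := by
  have : (capIn g).euler =
    ∑ a, (2 - 2 * (g a : ℤ)) - (Fintype.card A : ℤ) - (Fintype.card Empty : ℤ) := rfl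
  rw [this]
  simp only [Finset.sum_sub_distrib]
  simp
  ring

theorem euler_capOut [Fintype A] (g : A → ℕ) : (capOut g).euler = ∑ a, (1 - 2 * (g a : ℤ)) := by
  have : (capOut g).euler =
    ∑ a, (2 - 2 * (g a : ℤ)) - (Fintype.card Empty : ℤ) - (Fintype.card A : ℤ) := rfl
  rw [this]
  simp only [Finset.sum_sub_distrib]
  simp
  ring

end Surface

/-! ### Delooping of circles -/

section delooping

variable {R : Type u} [CommRing R] [Invertible (2 : R)]

open Classical in
/-- Neck cutting at the circles in `U`; at a circle in `t` the handle is on the incoming cap, at the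
other circles in `U` on the outgoing one. -/
theorem two_pow_smul_cylinder (Y : Cob R) (U : Finset Y.circles) :
    (2 : R) ^ U.card • (Cob.ofSurface (Surface.cylinder Y.circles) : Y ⟶ Y) =
      ∑ t ∈ U.powerset, Cob.ofSurface (Surface.cut U (fun b => if b ∈ t then 1 else 0)
        fun b => if b ∈ t then 0 else 1) := by
  induction U using Finset.induction_on with
  | empty =>
    rw [Finset.powerset_empty, Finset.sum_singleton, Finset.card_empty, pow_zero, one_smul]
    refine (Cob.ofSurface_eq (Surface.Homeo.trans (Surface.cut_homeo ?_ ?_)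
      (Surface.cut_empty fun _ => 0))).symm
    · intro a
      rw [if_neg (Finset.notMem_empty a)]
    · intro a ha
      exact absurd ha (Finset.notMem_empty a)
  | insert a U ha ih =>
    rw [Finset.sum_powerset_insert ha, Finset.card_insert_of_notMem ha, pow_succ', mul_smul, ih,
      Finset.smul_sum, ← Finset.sum_add_distrib]
    refine Finset.sum_congr rfl fun t ht => ?_
    have hat : a ∉ t := fun h => ha (Finset.mem_powerset.1 ht h)
    -- The neck at `a` is cut in the surface whose two caps at `a` both have genus zero; the two
    -- handles then account for the subsets `insert a t` and `t` of `insert a U`.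
    let S := Surface.cut (insert a U) (fun b => if b ∈ t then 1 else 0)
      (Function.update (fun b => if b ∈ t then 0 else 1) a 0)
    have h := Cob.two_smul_ofSurface_tube (X := Y) (Y := Y) S (Sum.inl a)
      (Sum.inr ⟨a, Finset.mem_insert_self a U⟩)
    have h1 : (S.tube (Sum.inl a) (Sum.inr ⟨a, Finset.mem_insert_self a U⟩)).Homeo
        (Surface.cut U (fun b => if b ∈ t then 1 else 0) fun b => if b ∈ t then 0 else 1) := by
      refine (Surface.cut_insert_tube ha (by simp)).trans
        (Surface.cut_homeo (fun _ => rfl) fun b hb => ?_)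
      rw [Function.update_of_ne (by rintro rfl; exact ha hb)]
    have h2 : (S.handle (Sum.inl a)).Homeo (Surface.cut (insert a U)
        (fun b => if b ∈ insert a t then 1 else 0) fun b => if b ∈ insert a t then 0 else 1) := by
      refine Surface.cut_handle_inl (by simp [hat]) (fun b hb => by simp [hb]) fun b _ => ?_
      by_cases hba : b = a
      · subst hba; simp
      · simp [hba]
    have h3 : (S.handle (Sum.inr ⟨a, Finset.mem_insert_self a U⟩)).Homeo
        (Surface.cut (insert a U) (fun b => if b ∈ t then 1 else 0)
          fun b => if b ∈ t then 0 else 1) := by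
      exact Surface.cut_handle_inr _ (by simp [hat]) (fun _ => rfl) fun b _ hb => by simp [hb]
    rw [Cob.ofSurface_eq h1, Cob.ofSurface_eq h2, Cob.ofSurface_eq h3] at h
    rw [h, add_comm]

/-- The projection of a collection of circles to the summand `∅` that belongs to a choice of signs:
a disc at every negative circle and half of a punctured torus at every positive one. -/
noncomputable def deloopOut (Y : Cob R) (s : Y.circles → Bool) (n : ℤ) : Y ⟶ Cob.empty R n :=
  (∏ a, if s a = true then ⅟(2 : R) else 1) •
    Cob.ofSurface (Surface.capIn fun a => if s a = true then 1 else 0)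

/-- The inclusion of the summand `∅` that belongs to a choice of signs: a disc at every positive
circle and half of a punctured torus at every negative one. -/
noncomputable def deloopIn (Y : Cob R) (s : Y.circles → Bool) (n : ℤ) : Cob.empty R n ⟶ Y :=
  (∏ a, if s a = true then 1 else ⅟(2 : R)) •
    Cob.ofSurface (Surface.capOut fun a => if s a = true then 0 else 1)

/-- The entries of the identity matrix arise from the values `0`, `2`, `0` of the sphere, the torus
and the surface of genus two. -/
theorem deloopIn_comp_deloopOut (Y : Cob R) (s t : Y.circles → Bool) (m n : ℤ) :
    deloopIn Y s m ≫ deloopOut Y t n =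
      closedSurfaces R m n (if s = t then 1 else 0) := by
  classical
  let g : Y.circles → ℕ := fun a => (if s a = true then 0 else 1) + if t a = true then 1 else 0
  have h1 : (Cob.ofSurface (Surface.capOut fun a => if s a = true then 0 else 1) :
        Cob.empty R m ⟶ Y) ≫ (Cob.ofSurface (Surface.capIn fun a => if t a = true then 1 else 0) :
        Y ⟶ Cob.empty R n) = closedSurfaces R m n (∏ a, genusValue R (g a)) :=
    (Cob.ofSurface_comp (X := Cob.empty R m) (Y := Y) (Z := Cob.empty R n) _ _).trans
      ((Cob.ofSurface_eq (X := Cob.empty R m) (Y := Cob.empty R n)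
        (Surface.capOut_glue_capIn _ _)).trans (ofSurface_eq_closedSurfaces m n _))
  rw [deloopIn, deloopOut, Linear.smul_comp, Linear.comp_smul, h1, smul_smul,
    ← Finset.prod_mul_distrib, ← map_smul, smul_eq_C_mul, map_prod, ← Finset.prod_mul_distrib]
  congr 1
  have hone : genusValue R 1 = C 2 := by
    rw [map_ofNat]
    simpa using genusValue_odd R 0
  have h2 : ∀ a, C ((if s a = true then 1 else ⅟(2 : R)) * if t a = true then ⅟(2 : R) else 1) *
      genusValue R (g a) = if s a = t a then 1 else 0 := by
    intro a
    cases hs : s a <;> cases ht : t a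
    · simp [g, hs, ht, hone, ← C_mul]
    · simp [g, hs, ht, genusValue_even R even_two]
    · simp [g, hs, ht, genusValue_even R Even.zero]
    · simp [g, hs, ht, hone, ← C_mul]
  simp only [h2]
  rw [Finset.prod_ite_zero]
  simp [funext_iff]

theorem sum_deloopOut_comp_deloopIn (Y : Cob R) (n : (Y.circles → Bool) → ℤ)
    [Fintype (Y.circles → Bool)] :
    ∑ s, deloopOut Y s (n s) ≫ deloopIn Y s (n s) = 𝟙 Y := by
  classical
  have h1 : ∀ s : Y.circles → Bool, deloopOut Y s (n s) ≫ deloopIn Y s (n s) =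
      (⅟(2 : R)) ^ Fintype.card Y.circles • Cob.ofSurface (Surface.cut Finset.univ
        (fun a => if s a = true then 1 else 0) fun a => if s a = true then 0 else 1) := by
    intro s
    have h1 : (Cob.ofSurface (Surface.capIn fun a => if s a = true then 1 else 0) :
        Y ⟶ Cob.empty R (n s)) ≫
        (Cob.ofSurface (Surface.capOut fun a => if s a = true then 0 else 1) :
        Cob.empty R (n s) ⟶ Y) = _ :=
      (Cob.ofSurface_comp (X := Y) (Y := Cob.empty R (n s)) (Z := Y) _ _).trans
        (Cob.ofSurface_eq (Surface.capIn_glue_capOut _ _))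
    rw [deloopIn, deloopOut, Linear.smul_comp, Linear.comp_smul, h1, smul_smul,
      ← Finset.prod_mul_distrib]
    congr 1
    refine (Finset.prod_congr rfl fun a _ => ?_).trans
      (Finset.prod_const (ι := Y.circles) (s := Finset.univ) (⅟(2 : R)))
    cases s a <;> simp
  have h2 := two_pow_smul_cylinder Y Finset.univ
  rw [Finset.powerset_univ, Finset.card_univ] at h2
  have h3 : (𝟙 Y : Y ⟶ Y) = Cob.ofSurface (Surface.cylinder Y.circles) := rfl
  rw [Finset.sum_congr rfl fun s _ => h1 s, ← Finset.smul_sum, h3]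
  have h4 : ∑ s : Y.circles → Bool, (Cob.ofSurface (Surface.cut Finset.univ
        (fun a => if s a = true then 1 else 0) fun a => if s a = true then 0 else 1) : Y ⟶ Y) =
      (2 : R) ^ Fintype.card Y.circles • Cob.ofSurface (Surface.cylinder Y.circles) := by
    rw [h2]
    refine Finset.sum_bij' (fun s _ => Finset.univ.filter fun a => s a = true)
      (fun t _ a => decide (a ∈ t)) (fun _ _ => Finset.mem_univ _) (fun _ _ => Finset.mem_univ _)
      (fun s _ => by simp) (fun t _ => by simp) (fun s _ => ?_)
    simp only [Finset.mem_filter, Finset.mem_univ, true_and]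
  rw [h4, smul_smul, ← mul_pow, invOf_mul_self, one_pow, one_smul]

open Classical in
/-- Every circle of a column is replaced by two generators, of degrees `1` (for `true`) and `-1`. -/
noncomputable def deloopedModule (M : Mat_ (Cob R)) : FreeMod R where
  ι := Σ i : M.ι, ((M.X i).circles → Bool)
  deg x := (M.X x.1).shift + ∑ a, if x.2 a = true then 1 else -1

/-- The projections of a column to the summands `∅`, as a matrix. The factor that is an entry of the
identity matrix makes the entries vanish whose row and column belong to different objects. -/
noncomputable def deloopHom (M : Mat_ (Cob R)) : M ⟶ (realize R).obj (deloopedModule M) :=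
  fun i (x : (deloopedModule M).ι) =>
    (𝟙 M : M ⟶ M) i x.1 ≫ deloopOut (M.X x.1) x.2 ((deloopedModule M).deg x)

/-- The inclusions of the summands `∅` into a column, as a matrix. -/
noncomputable def deloopInv (M : Mat_ (Cob R)) : (realize R).obj (deloopedModule M) ⟶ M :=
  fun (x : (deloopedModule M).ι) i =>
    deloopIn (M.X x.1) x.2 ((deloopedModule M).deg x) ≫ (𝟙 M : M ⟶ M) x.1 i

theorem deloopHom_comp_deloopInv (M : Mat_ (Cob R)) : deloopHom M ≫ deloopInv M = 𝟙 M := by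
  classical
  ext i j
  change ∑ x : (deloopedModule M).ι,
    ((𝟙 M : M ⟶ M) i x.1 ≫ deloopOut (M.X x.1) x.2 ((deloopedModule M).deg x)) ≫
      (deloopIn (M.X x.1) x.2 ((deloopedModule M).deg x) ≫ (𝟙 M : M ⟶ M) x.1 j) = _
  refine (Fintype.sum_sigma _).trans ?_
  have h : ∀ k : M.ι, ∑ s : (M.X k).circles → Bool,
      ((𝟙 M : M ⟶ M) i k ≫ deloopOut (M.X k) s ((deloopedModule M).deg ⟨k, s⟩)) ≫
        (deloopIn (M.X k) s ((deloopedModule M).deg ⟨k, s⟩) ≫ (𝟙 M : M ⟶ M) k j) =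
      (𝟙 M : M ⟶ M) i k ≫ (𝟙 M : M ⟶ M) k j := by
    intro k
    have h1 := sum_deloopOut_comp_deloopIn (M.X k) fun s => (deloopedModule M).deg ⟨k, s⟩
    have h2 : ∀ s : (M.X k).circles → Bool,
        ((𝟙 M : M ⟶ M) i k ≫ deloopOut (M.X k) s ((deloopedModule M).deg ⟨k, s⟩)) ≫
          (deloopIn (M.X k) s ((deloopedModule M).deg ⟨k, s⟩) ≫ (𝟙 M : M ⟶ M) k j) =
        (𝟙 M : M ⟶ M) i k ≫ (deloopOut (M.X k) s ((deloopedModule M).deg ⟨k, s⟩) ≫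
          deloopIn (M.X k) s ((deloopedModule M).deg ⟨k, s⟩)) ≫ (𝟙 M : M ⟶ M) k j := by
      intro s
      simp only [Category.assoc]
    rw [Finset.sum_congr rfl fun s _ => h2 s, ← Preadditive.comp_sum, ← Preadditive.sum_comp, h1,
      Category.id_comp]
  refine (Finset.sum_congr rfl fun k _ => h k).trans ?_
  rw [← Mat_.comp_apply, Category.comp_id]

theorem deloopInv_comp_deloopHom (M : Mat_ (Cob R)) : deloopInv M ≫ deloopHom M = 𝟙 _ := by
  classical
  have h : ∀ x y : (deloopedModule M).ι, (deloopInv M ≫ deloopHom M) x y =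
      deloopIn (M.X x.1) x.2 ((deloopedModule M).deg x) ≫ (𝟙 M : M ⟶ M) x.1 y.1 ≫
        deloopOut (M.X y.1) y.2 ((deloopedModule M).deg y) := by
    intro x y
    have h1 : (𝟙 M : M ⟶ M) x.1 y.1 =
        ∑ i, (𝟙 M : M ⟶ M) x.1 i ≫ (𝟙 M : M ⟶ M) i y.1 := by
      rw [← Mat_.comp_apply, Category.comp_id]
    rw [h1, Preadditive.sum_comp, Preadditive.comp_sum]
    refine Finset.sum_congr rfl fun i _ => ?_
    change (_ ≫ _) ≫ (_ ≫ _) = _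
    simp only [Category.assoc]
    exact Category.assoc _ _ _
  ext x y
  refine (h x y).trans ?_
  obtain ⟨i, s⟩ := x
  obtain ⟨j, t⟩ := y
  by_cases hij : i = j
  · subst hij
    rw [Mat_.id_apply_self, Category.id_comp, deloopIn_comp_deloopOut]
    by_cases hst : s = t
    · subst hst
      rw [if_pos rfl, closedSurfaces_one]
      exact (Mat_.id_apply_self ((realize R).obj (deloopedModule M)) ⟨i, s⟩).symm
    · rw [if_neg hst, map_zero]
      refine (Mat_.id_apply_of_ne ((realize R).obj (deloopedModule M)) ⟨i, s⟩ ⟨i, t⟩ ?_).symm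
      exact fun h => hst (eq_of_heq (Sigma.mk.inj h).2)
  · rw [Mat_.id_apply_of_ne _ _ _ hij, Limits.zero_comp, Limits.comp_zero]
    refine (Mat_.id_apply_of_ne ((realize R).obj (deloopedModule M)) ⟨i, s⟩ ⟨j, t⟩ ?_).symm
    exact fun h => hij (Sigma.mk.inj h).1

/-- Delooping of all circles in a column. -/
noncomputable def deloopIso (M : Mat_ (Cob R)) : M ≅ (realize R).obj (deloopedModule M) where
  hom := deloopHom M
  inv := deloopInv M
  hom_inv_id := deloopHom_comp_deloopInv M
  inv_hom_id := deloopInv_comp_deloopHom M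

end delooping

/-! ### Degrees of morphisms -/

namespace Cob

variable {R : Type u} [CommRing R]

theorem ofSurface_mem_degreePart {X Y : Cob R} {d : ℤ} (S : Surface X.circles Y.circles)
    (h : S.euler + Y.shift - X.shift = d) : (ofSurface S : X ⟶ Y) ∈ degreePart X Y d :=
  Submodule.subset_span ⟨S, h, rfl⟩

theorem comp_mem_degreePart {X Y Z : Cob R} {f : X ⟶ Y} {g : Y ⟶ Z}
    (hf : f ∈ degreePart X Y 0) (hg : g ∈ degreePart Y Z 0) : f ≫ g ∈ degreePart X Z 0 := by
  induction hf using Submodule.span_induction with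
  | zero => rw [Limits.zero_comp]; exact zero_mem _
  | add f f' _ _ h h' => rw [Preadditive.add_comp]; exact add_mem h h'
  | smul a f _ h => rw [Linear.smul_comp]; exact Submodule.smul_mem _ a h
  | mem f h =>
    obtain ⟨S, hS, rfl⟩ := h
    induction hg using Submodule.span_induction with
    | zero => rw [Limits.comp_zero]; exact zero_mem _
    | add f f' _ _ h h' => rw [Preadditive.comp_add]; exact add_mem h h'
    | smul a f _ h => rw [Linear.comp_smul]; exact Submodule.smul_mem _ a h
    | mem g h =>
      obtain ⟨T, hT, rfl⟩ := h
      rw [ofSurface_comp]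
      refine ofSurface_mem_degreePart _ ?_
      rw [Surface.euler_glue]
      linarith

theorem id_mem_degreePart (X : Cob R) : 𝟙 X ∈ degreePart X X 0 := by
  refine ofSurface_mem_degreePart (Surface.cylinder X.circles) ?_
  have : (Surface.cylinder X.circles).euler = (∑ _a : X.circles, (2 - 2 * ((0 : ℕ) : ℤ))) -
    Fintype.card X.circles - Fintype.card X.circles := rfl
  rw [this]
  simp
  ring

theorem matDegreeZero_id (M : Mat_ (Cob R)) : MatDegreeZero (𝟙 M) := by
  intro i j
  by_cases h : i = j
  · subst h
    rw [Mat_.id_apply_self]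
    exact id_mem_degreePart _
  · rw [Mat_.id_apply_of_ne _ _ _ h]
    exact zero_mem _

theorem MatDegreeZero.comp {M N P : Mat_ (Cob R)} {f : M ⟶ N} {g : N ⟶ P}
    (hf : MatDegreeZero f) (hg : MatDegreeZero g) : MatDegreeZero (f ≫ g) := by
  intro i k
  rw [Mat_.comp_apply]
  exact Submodule.sum_mem _ fun j _ => comp_mem_degreePart (hf i j) (hg j k)

end Cob

section degree

variable {R : Type u} [CommRing R]

/-- Saddles have Euler characteristic `-1`, which the degree shifts compensate. -/
theorem matDegreeZero_differential (D : LinkDiagram) (h : ℤ) :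
    Cob.MatDegreeZero (D.differential R h) := by
  intro v w
  refine Submodule.sum_mem _ fun c _ => ?_
  rw [LinkDiagram.edgeMap]
  split_ifs with hc
  · refine Submodule.smul_mem _ _ (Cob.ofSurface_mem_degreePart _ ?_)
    have h1 := LinkDiagram.sum_saddle v.1 w.1 c hc.1 hc.2 fun _ => 1
    have h2 : (D.saddle v.1 w.1).euler = (∑ _k : D.SaddlePieces v.1 w.1, (2 - 2 * ((0 : ℕ) : ℤ))) -
      Fintype.card (D.Circles v.1) - Fintype.card (D.Circles w.1) := rfl
    have h3 := LinkDiagram.height_update v.1 c hc.1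
    rw [← hc.2] at h3
    simp at h1 h2
    rw [h2]
    simp only [h3]
    push_cast
    linarith
  · exact zero_mem _

theorem matDegreeZero_complex_d (D : LinkDiagram) (h h' : ℤ) :
    Cob.MatDegreeZero ((D.complex R).d h h') := by
  by_cases hh : h + 1 = h'
  · subst hh
    have : (D.complex R).d h (h + 1) = D.differential R h := CochainComplex.of_d _ _ _
    rw [this]
    exact matDegreeZero_differential D h
  · rw [(D.complex R).shape h h' hh]
    exact fun _ _ => zero_mem _

/-- The value of a closed surface is homogeneous, where `T` has degree `-4`, the Euler characteristic
of a surface of genus three. -/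
theorem euler_eq_of_closedValue_coeff_ne_zero {S : Surface Empty Empty} {k : ℕ}
    (hk : (closedValue R S).coeff k ≠ 0) : S.euler = -4 * (k : ℤ) := by
  by_cases h : ∃ p, Even (S.genus p)
  · obtain ⟨p, hp⟩ := h
    refine absurd ?_ hk
    rw [closedValue, Finset.prod_eq_zero (Finset.mem_univ p) (genusValue_even R hp), coeff_zero]
  · push Not at h
    have h1 : ∀ p, genusValue R (S.genus p) = 2 * X ^ (S.genus p / 2) := fun p =>
      if_neg (by simpa using h p)
    have h2 : closedValue R S =
        C (2 ^ Fintype.card S.K) * X ^ (∑ p, S.genus p / 2) := by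
      rw [closedValue]
      simp only [h1]
      rw [Finset.prod_mul_distrib, Finset.prod_pow_eq_pow_sum, Finset.prod_const, Finset.card_univ,
        C_pow, map_ofNat]
    rw [h2, coeff_C_mul_X_pow] at hk
    have h3 : k = ∑ p, S.genus p / 2 := by
      by_contra hne
      exact hk (if_neg hne)
    have h4 : S.euler = ∑ p, (2 - 2 * (S.genus p : ℤ)) := by
      simp [Surface.euler]
    rw [h4, h3]
    push_cast
    rw [Finset.mul_sum]
    refine Finset.sum_congr rfl fun p _ => ?_
    have := Nat.not_even_iff_odd.1 (by simpa using h p : ¬ Even (S.genus p))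
    obtain ⟨l, hl⟩ := this
    omega

variable [Invertible (2 : R)]

theorem matDegreeZero_deloopHom (M : Mat_ (Cob R)) : Cob.MatDegreeZero (deloopHom M) := by
  rintro i ⟨j, s⟩
  refine Cob.comp_mem_degreePart (Cob.matDegreeZero_id M i j)
    (Submodule.smul_mem _ _ (Cob.ofSurface_mem_degreePart _ ?_))
  have h : ∑ a, (if s a = true then (1 : ℤ) else -1) =
      - ∑ a, (1 - 2 * ((if s a = true then 1 else 0 : ℕ) : ℤ)) := by
    rw [← Finset.sum_neg_distrib]
    refine Finset.sum_congr rfl fun a _ => ?_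
    cases s a <;> simp
  change (Surface.capIn fun a => if s a = true then 1 else 0).euler +
    ((M.X j).shift + ∑ a, (if s a = true then (1 : ℤ) else -1)) - (M.X j).shift = 0
  rw [Surface.euler_capIn]
  linarith

theorem matDegreeZero_deloopInv (M : Mat_ (Cob R)) : Cob.MatDegreeZero (deloopInv M) := by
  rintro ⟨j, s⟩ i
  refine Cob.comp_mem_degreePart (Submodule.smul_mem _ _ (Cob.ofSurface_mem_degreePart _ ?_))
    (Cob.matDegreeZero_id M j i)
  have h : ∑ a, (if s a = true then (1 : ℤ) else -1) =
      ∑ a, (1 - 2 * ((if s a = true then 0 else 1 : ℕ) : ℤ)) := by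
    refine Finset.sum_congr rfl fun a _ => ?_
    cases s a <;> simp
  change (Surface.capOut fun a => if s a = true then 0 else 1).euler + (M.X j).shift -
    ((M.X j).shift + ∑ a, (if s a = true then (1 : ℤ) else -1)) = 0
  rw [Surface.euler_capOut]
  linarith

theorem value_coeff_eq_zero {m n : ℤ} {f : Cob.empty R m ⟶ Cob.empty R n}
    (hf : f ∈ Cob.degreePart (Cob.empty R m) (Cob.empty R n) 0) {k : ℕ}
    (hk : n - m - 4 * (k : ℤ) ≠ 0) : (value m n f).coeff k = 0 := by
  induction hf using Submodule.span_induction with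
  | zero => rw [map_zero, coeff_zero]
  | add f g _ _ hf hg => rw [map_add, coeff_add, hf, hg, add_zero]
  | smul a f _ hf => rw [map_smul, coeff_smul, hf, smul_zero]
  | mem f h =>
    obtain ⟨S, hS, rfl⟩ := h
    by_contra hc
    have h1 := euler_eq_of_closedValue_coeff_ne_zero
      ((congrArg (coeff · k) (value_ofSurface m n S)).symm.trans_ne hc)
    have hS' : S.euler + n - m = 0 := hS
    exact hk (by linarith)

theorem degreeZero_of_realize {F G : FreeMod R} {f : F ⟶ G}
    (hf : Cob.MatDegreeZero ((realize R).map f)) : FreeMod.DegreeZero f := by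
  intro i j k hk
  rw [entry_of_realize_map] at hk
  exact not_not.1 fun h => hk (value_coeff_eq_zero (hf i j) h)

/-! ### Delooping of complexes -/

/-- The complex of free modules that is obtained from a complex of columns by delooping. -/
noncomputable def deloopedComplex (K : CochainComplex (Mat_ (Cob R)) ℤ) :
    CochainComplex (FreeMod R) ℤ where
  X h := deloopedModule (K.X h)
  d h h' := (realize R).preimage ((deloopIso (K.X h)).inv ≫ K.d h h' ≫ (deloopIso (K.X h')).hom)
  shape h h' hh := by
    refine (realize R).map_injective ?_
    rw [Functor.map_preimage, K.shape h h' hh, Limits.zero_comp, Limits.comp_zero,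
      Functor.map_zero]
  d_comp_d' h h' h'' _ _ := by
    refine (realize R).map_injective ?_
    rw [Functor.map_comp, Functor.map_preimage, Functor.map_preimage, Functor.map_zero]
    simp

/-- Delooping as an isomorphism of complexes. -/
noncomputable def deloopComplexIso (K : CochainComplex (Mat_ (Cob R)) ℤ) :
    K ≅ ((realize R).mapHomologicalComplex (ComplexShape.up ℤ)).obj (deloopedComplex K) :=
  HomologicalComplex.Hom.isoOfComponents (fun h => deloopIso (K.X h)) fun h h' _ => by
    have : (((realize R).mapHomologicalComplex (ComplexShape.up ℤ)).obj
        (deloopedComplex K)).d h h' =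
        (deloopIso (K.X h)).inv ≫ K.d h h' ≫ (deloopIso (K.X h')).hom :=
      (realize R).map_preimage _
    rw [this]
    exact (deloopIso (K.X h)).hom_inv_id_assoc _

end degree

theorem theorem3p1 (R : Type u) [CommRing R] [Invertible (2 : R)] :
    (realize R).Full ∧ (realize R).Faithful ∧
      ∀ D : LinkDiagram, ∃ (C : CochainComplex (FreeMod R) ℤ)
        (φ : D.complex R ≅ ((realize R).mapHomologicalComplex (ComplexShape.up ℤ)).obj C),
        (∀ h, C.X h = D.deloop R h) ∧
        (∀ h h', FreeMod.DegreeZero (C.d h h')) ∧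
        ∀ h, Cob.MatDegreeZero (φ.hom.f h) ∧ Cob.MatDegreeZero (φ.inv.f h) := by
  refine ⟨inferInstance, inferInstance, fun D => ⟨deloopedComplex (D.complex R),
    deloopComplexIso (D.complex R), fun h => rfl, fun h h' => ?_, fun h => ⟨?_, ?_⟩⟩⟩
  · refine degreeZero_of_realize ?_
    have : (realize R).map ((deloopedComplex (D.complex R)).d h h') =
        deloopInv _ ≫ _ ≫ deloopHom _ :=
      (realize R).map_preimage _
    rw [this]
    exact (matDegreeZero_deloopInv _).comp
      ((matDegreeZero_complex_d D h h').comp (matDegreeZero_deloopHom _))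
  · exact matDegreeZero_deloopHom _
  · exact matDegreeZero_deloopInv _
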